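/- Let $d\ge 1$, $T\ge 1$, $\delta\in(0,1)$, $\lambda>0$, $\sigma_{\min}>0$ (for instance $\sigma_{\min}=1/\sqrt T$), and write $\|x\|_A=\sqrt{x^\top A x}$ for a positive definite matrix $A$. **Heavy-tailed linear bandit.** Let $(\mathcal F_t)_{t\ge 0}$ be a filtration on a probability space, $(\mathcal D_t)_{t\ge1}$ decision sets in $\mathbb R^d$, and $\theta^*\in\mathbb R^d$ with $\|\theta^*\|\le B$. In round $t\ge1$ the agent plays an $\mathcal F_{t-1}$-measurable $\phi_t\in\mathcal D_t$ with $\|\phi_t\|\le L$ (chosen by an arbitrary rule, in particular by the optimistic rule of AdaOFUL) and observes $y_t=\langle\phi_t,\theta^*\rangle+\varepsilon_t$ and $\nu_t$, where $\nu_t\ge0$ is $\mathcal F_{t-1}$-measurable and $\varepsilon_t$ is $\mathcal F_t$-measurable and integrable with $\mathbb E[\varepsilon_t\mid\mathcal F_{t-1}]=0$ and $\mathbb E[\varepsilon_t^2\mid\mathcal F_{t-1}]=\nu_t^2$. **Algorithm (AdaOFUL estimator).** Put $c_0=\dfrac1{6\sqrt{3\log(2T^2/\delta)}}$, $c_1=\dfrac1{42\log(2T^2/\delta)}$,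 $H_0=\lambda I$, $\theta_0=0$, and for $1\le t\le T$ $$\sigma_t=\max\Big\{\nu_t,\ \sigma_{\min},\ \frac{\|\phi_t\|_{H_{t-1}^{-1}}}{c_0},\ \frac{\sqrt{LB}\,\|\phi_t\|_{H_{t-1}^{-1}}^{1/2}}{c_1^{1/4}d^{1/4}}\Big\},\quad w_t=\Big\|\frac{\phi_t}{\sigma_t}\Big\|_{H_{t-1}^{-1}},\quad \tau_t=\tau_0\frac{\sqrt{1+w_t^2}}{w_t},\quad H_t=H_{t-1}+\frac{\phi_t\phi_t^\top}{\sigma_t^2}.$$ With the pseudo-Huber loss $\ell_\tau(x)=\tau(\sqrt{\tau^2+x^2}-\tau)$, let $$\theta_t=\operatorname*{argmin}_{\|\theta\|\le B}\ \frac\lambda2\|\theta\|^2+\sum_{s=1}^t\ell_{\tau_s}\Big(\frac{y_s-\langle\phi_s,\theta\rangle}{\sigma_s}\Big)\qquad(1\le t\le T).$$ (Rounds with $\phi_s=0$, where $\tau_s$ is undefined, do not depend on $\theta$ and are omitted from the sum.) **Theorem.** Let $\kappa=d\log\big(1+\tfrac{TL^2}{d\lambda\sigma_{\min}^2}\big)$.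 If $\tau_0\sqrt{\log(2T^2/\delta)}\ge\max\{\sqrt{2\kappa},\,2\sqrt d\}$, then with probability at least $1-3\delta$, $$\|\theta_t-\theta^*\|_{H_t}\le\beta_t\qquad\text{for all }0\le t\le T,$$ where $\beta_0=\sqrt\lambda B$ and, for $1\le t\le T$, $$\beta_t=32\Big(\frac\kappa{\tau_0}+\sqrt{\kappa\log\frac{2t^2}\delta}+\tau_0\log\frac{2t^2}\delta\Big)+5\sqrt\lambda B.$$ -/

import Mathlib

open MeasureTheory ProbabilityTheory

noncomputable section

namespace AdaOFUL

/-- The weighted norm `‖x‖_A = √(xᵀ A x)` of a vector `x ∈ ℝᵈ`. -/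
def wnorm {d : ℕ} (A : Matrix (Fin d) (Fin d) ℝ) (x : EuclideanSpace ℝ (Fin d)) : ℝ :=
  Real.sqrt (x.ofLp ⬝ᵥ A.mulVec x.ofLp)

/-- The pseudo-Huber loss `ℓ_τ(x) = τ (√(τ² + x²) - τ)`. -/
def pseudoHuber (τ x : ℝ) : ℝ :=
  τ * (Real.sqrt (τ ^ 2 + x ^ 2) - τ)

/-- Heavy-tailed stochastic linear bandit, as a predicate on a filtered probability space.
In round `t ≥ 1` the agent picks the arm `φ t` from the decision set `D t` and observes the reward
`y t = ⟪φ t, θstar⟫ + ε t` and its conditional variance `(ν t)²`. The noise is a martingale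
difference with conditional second moment `(ν t)²`, and nothing else is assumed about its tails.
The conditional second moment is the conditional expectation of a `[0, ∞]`-valued variable, so that
`ε t` itself is integrable, but `E[(ε t)²]` may be infinite. -/
structure IsHeavyTailedBandit {d : ℕ} {Ω : Type*} {mΩ : MeasurableSpace Ω} (μ : Measure Ω)
    (ℱ : Filtration ℕ mΩ) (D : ℕ → Set (EuclideanSpace ℝ (Fin d)))
    (φ : ℕ → Ω → EuclideanSpace ℝ (Fin d)) (ν y ε : ℕ → Ω → ℝ)
    (θstar : EuclideanSpace ℝ (Fin d)) (L B : ℝ) : Prop where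
  arm_mem : ∀ t, 1 ≤ t → ∀ ω, φ t ω ∈ D t
  arm_predictable : ∀ t, 1 ≤ t → StronglyMeasurable[ℱ (t - 1)] (φ t)
  arm_norm_le : ∀ t, 1 ≤ t → ∀ ω, ‖φ t ω‖ ≤ L
  reward_eq : ∀ t, 1 ≤ t → ∀ ω, y t ω = inner ℝ (φ t ω) θstar + ε t ω
  noise_adapted : ∀ t, 1 ≤ t → StronglyMeasurable[ℱ t] (ε t)
  noise_integrable : ∀ t, 1 ≤ t → Integrable (ε t) μ
  noise_mean : ∀ t, 1 ≤ t → μ[ε t | ℱ (t - 1)] =ᵐ[μ] 0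
  std_predictable : ∀ t, 1 ≤ t → StronglyMeasurable[ℱ (t - 1)] (ν t)
  std_nonneg : ∀ t, 1 ≤ t → ∀ ω, 0 ≤ ν t ω
  noise_sq : ∀ t, 1 ≤ t →
    condLExp (ℱ (t - 1)) μ (fun ω => ENNReal.ofReal (ε t ω ^ 2))
      =ᵐ[μ] fun ω => ENNReal.ofReal (ν t ω ^ 2)
  param_norm_le : ‖θstar‖ ≤ B

/-- The numerical inputs of the algorithm in dimension `d`: the horizon `T`, the bounds `L` and `B`
on arms and parameters, the ridge coefficient `lam`, the confidence level `δ`, the robustification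
hyper-parameter `τ₀`, and the variance floor `σmin`. -/
structure Params (d : ℕ) where
  T : ℕ
  L : ℝ
  B : ℝ
  lam : ℝ
  δ : ℝ
  τ₀ : ℝ
  σmin : ℝ

namespace Params

variable {d : ℕ} (p : Params d)

/-- `log (2 t² / δ)`. -/
def logTerm (t : ℕ) : ℝ := Real.log (2 * (t : ℝ) ^ 2 / p.δ)

/-- `c₀ = 1 / (6 √(3 log (2T²/δ)))`. -/
def c₀ : ℝ := 1 / (6 * Real.sqrt (3 * p.logTerm p.T))

/-- `c₁ = 1 / (42 log (2T²/δ))`. -/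
def c₁ : ℝ := 1 / (42 * p.logTerm p.T)

/-- `κ = d log (1 + T L² / (d λ σ_min²))`. -/
def κ : ℝ := d * Real.log (1 + p.T * p.L ^ 2 / (d * p.lam * p.σmin ^ 2))

/-- The confidence radius; its value in round `0` is the initialization `√λ B`. -/
def β (t : ℕ) : ℝ :=
  if t = 0 then Real.sqrt p.lam * p.B
  else 32 * (p.κ / p.τ₀ + Real.sqrt (p.κ * p.logTerm t) + p.τ₀ * p.logTerm t)
    + 5 * Real.sqrt p.lam * p.B

/-- The surrogate standard deviation of a round with arm `x` and conditional standard deviation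
`v`, when `H` is the shape matrix of the preceding round. -/
def surrogate (H : Matrix (Fin d) (Fin d) ℝ) (x : EuclideanSpace ℝ (Fin d)) (v : ℝ) : ℝ :=
  max (max v p.σmin)
    (max (wnorm H⁻¹ x / p.c₀)
      (Real.sqrt (p.L * p.B) * Real.sqrt (wnorm H⁻¹ x)
        / (p.c₁ ^ (1 / 4 : ℝ) * (d : ℝ) ^ (1 / 4 : ℝ))))

/-- The shape matrices of a trajectory of arms and conditional standard deviations: `H₀ = λ I` and
`H_t = H_{t-1} + (φ_t / σ_t) (φ_t / σ_t)ᵀ`. -/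
def shape (φ : ℕ → EuclideanSpace ℝ (Fin d)) (ν : ℕ → ℝ) : ℕ → Matrix (Fin d) (Fin d) ℝ
  | 0 => p.lam • (1 : Matrix (Fin d) (Fin d) ℝ)
  | t + 1 =>
    let σ := p.surrogate (shape φ ν t) (φ (t + 1)) (ν (t + 1))
    shape φ ν t + Matrix.vecMulVec (σ⁻¹ • φ (t + 1)).ofLp (σ⁻¹ • φ (t + 1)).ofLp

/-- `σ_t`, for `t ≥ 1`. -/
def σ (φ : ℕ → EuclideanSpace ℝ (Fin d)) (ν : ℕ → ℝ) (t : ℕ) : ℝ :=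
  p.surrogate (p.shape φ ν (t - 1)) (φ t) (ν t)

/-- The importance measure `w_t = ‖φ_t / σ_t‖_{H_{t-1}⁻¹}`, for `t ≥ 1`. -/
def w (φ : ℕ → EuclideanSpace ℝ (Fin d)) (ν : ℕ → ℝ) (t : ℕ) : ℝ :=
  wnorm (p.shape φ ν (t - 1))⁻¹ ((p.σ φ ν t)⁻¹ • φ t)

/-- The robustification parameter `τ_t = τ₀ √(1 + w_t²) / w_t`, for `t ≥ 1`. If `w_t = 0`, then
`φ_t = 0`, and the summand of round `t` in the loss below is constant in `θ`. -/
def τ (φ : ℕ → EuclideanSpace ℝ (Fin d)) (ν : ℕ → ℝ) (t : ℕ) : ℝ :=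
  p.τ₀ * Real.sqrt (1 + p.w φ ν t ^ 2) / p.w φ ν t

/-- The ridge-regularized adaptive pseudo-Huber loss `L_t(θ)`. -/
def loss (φ : ℕ → EuclideanSpace ℝ (Fin d)) (ν y : ℕ → ℝ) (t : ℕ)
    (θ : EuclideanSpace ℝ (Fin d)) : ℝ :=
  p.lam / 2 * ‖θ‖ ^ 2 +
    ∑ s ∈ Finset.Icc 1 t,
      pseudoHuber (p.τ φ ν s) ((y s - inner ℝ (φ s) θ) / p.σ φ ν s)

/-- `θ` is the sequence of estimators on a trajectory: `θ₀ = 0`, and `θ_t` minimizes `L_t` over the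
closed ball of radius `B` in every round `1 ≤ t ≤ T`. -/
def IsEstimator (φ : ℕ → EuclideanSpace ℝ (Fin d)) (ν y : ℕ → ℝ)
    (θ : ℕ → EuclideanSpace ℝ (Fin d)) : Prop :=
  θ 0 = 0 ∧ ∀ t, 1 ≤ t → t ≤ p.T →
    θ t ∈ Metric.closedBall (0 : EuclideanSpace ℝ (Fin d)) p.B ∧
      IsMinOn (p.loss φ ν y t) (Metric.closedBall 0 p.B) (θ t)

end Params

end AdaOFUL

end

/-! ### Rank-one updates of positive definite matrices. -/

namespace AdaOFUL

open Matrix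

section RankOne

variable {n : Type*} [Fintype n] {A : Matrix n n ℝ}

/-! Write `X_s` for the rescaled arm, `z_s` for the rescaled noise, `ψ_s` for the derivative of the
loss at `z_s`, `S_t = ∑ ψ_s X_s`, and `r_s = w_s² / (1 + w_s²)`. The elliptical potential lemma
gives `∑ r_s ≤ κ`. The proof reduces the claim to two random quantities and bounds each with an
exponential supermartingale.

Deterministic part (`wnorm_sub_le`). Compare the loss at the minimizer with the loss at the true
parameter, with `v` their difference. If `|z_s| ≤ τ_s / 2`, the loss of round `s` has quadratic
growth; the last entry of the maximum defining `σ_s` keeps `|X_s · v|` small enough for this. In the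
other rounds, the outliers, only convexity is used, and since `(X_s · v)² ≤ r_s ‖v‖²_H`, they cost
at most their total leverage. If that leverage is at most `1/6`, what remains is `‖v‖_H ≤ 4
(‖S_t‖_{H⁻¹} + √λ B)`, with `‖S_t‖_{H⁻¹}` replaced by any upper bound.

Self-normalized part. By the Sherman-Morrison formula `‖S‖²_{H⁻¹}` grows by at most `(2 ψ a + ψ² w²)
/ (1 + w²)`, where `a = X · H⁻¹ S`. The choice of `τ_s` yields `|ψ| w ≤ τ₀ √(1 + w²)`, which bounds
the increments, and the bias `|z - ψ| ≤ z² / τ` with `1 / τ ≤ w / τ₀`, which makes the drift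
proportional to `r_s`. Both need `|a| ≤ w b`, so `a` is set to zero once `‖S‖_{H⁻¹} > b`, a
predictable truncation. For each `t` separately, Markov's inequality bounds the truncated sum;
strong induction on `t` then shows that no truncation took place (`selfNorm_le_radius_sq`).

Outlier part (`sum_outlier_le`). An outlier has `z² > τ² / 4`, and `τ² r = τ₀²`, so its conditional
mean leverage is of order `r² / τ₀²`. The second entry involving `c₀` makes `r` small enough for the
same supermartingale argument. A union bound over all events concludes. -/

theorem posDef_add_vecMulVec (hA : A.PosDef) (x : n → ℝ) : (A + vecMulVec x x).PosDef :=
  hA.add_posSemidef (by simpa using posSemidef_vecMulVec_self_star x)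

theorem dotProduct_mulVec_symm (hA : A.PosDef) (x y : n → ℝ) :
    x ⬝ᵥ A *ᵥ y = y ⬝ᵥ A *ᵥ x := by
  have h : Aᵀ = A := by simpa using hA.isHermitian.eq
  rw [dotProduct_mulVec, dotProduct_comm, ← mulVec_transpose, h]

theorem dotProduct_mulVec_nonneg (hA : A.PosDef) (x : n → ℝ) : 0 ≤ x ⬝ᵥ A *ᵥ x := by
  simpa using hA.posSemidef.dotProduct_mulVec_nonneg x

theorem dotProduct_mulVec_sq_le (hA : A.PosDef) (x y : n → ℝ) :
    (x ⬝ᵥ A *ᵥ y) ^ 2 ≤ (x ⬝ᵥ A *ᵥ x) * (y ⬝ᵥ A *ᵥ y) := by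
  have h : ∀ t : ℝ, 0 ≤ (y ⬝ᵥ A *ᵥ y) * (t * t) + (2 * (x ⬝ᵥ A *ᵥ y)) * t + x ⬝ᵥ A *ᵥ x := by
    intro t
    have := dotProduct_mulVec_nonneg hA (x + t • y)
    simp only [mulVec_add, mulVec_smul, dotProduct_add, add_dotProduct, dotProduct_smul,
      smul_dotProduct, smul_eq_mul] at this
    rw [dotProduct_mulVec_symm hA y x] at this
    linarith
  have := discrim_le_zero h
  unfold discrim at this
  nlinarith

variable [DecidableEq n]

theorem mulVec_inv_mulVec (hA : A.PosDef) (x : n → ℝ) : A *ᵥ (A⁻¹ *ᵥ x) = x := by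
  rw [mulVec_mulVec, mul_nonsing_inv _ ((isUnit_iff_isUnit_det A).1 hA.isUnit), one_mulVec]

theorem dotProduct_sq_le (hA : A.PosDef) (x y : n → ℝ) :
    (x ⬝ᵥ y) ^ 2 ≤ (x ⬝ᵥ A⁻¹ *ᵥ x) * (y ⬝ᵥ A *ᵥ y) := by
  have h := dotProduct_mulVec_sq_le hA y (A⁻¹ *ᵥ x)
  rw [mulVec_inv_mulVec hA, dotProduct_comm (A⁻¹ *ᵥ x), dotProduct_comm y x] at h
  linarith

/-- The Sherman-Morrison formula, checked by multiplying out. -/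
theorem add_vecMulVec_inv (hA : A.PosDef) (x : n → ℝ) :
    (A + vecMulVec x x)⁻¹
      = A⁻¹ - (1 + x ⬝ᵥ A⁻¹ *ᵥ x)⁻¹ • vecMulVec (A⁻¹ *ᵥ x) (A⁻¹ *ᵥ x) := by
  have hq := dotProduct_mulVec_nonneg hA.inv x
  have hu : A * A⁻¹ = 1 := mul_nonsing_inv _ ((isUnit_iff_isUnit_det A).1 hA.isUnit)
  have ht : A⁻¹ᵀ = A⁻¹ := by simpa using hA.inv.isHermitian.eq
  have hx : x ᵥ* A⁻¹ = A⁻¹ *ᵥ x := by rw [← mulVec_transpose, ht]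
  refine inv_eq_right_inv ?_
  rw [mul_sub, add_mul, add_mul, hu, vecMulVec_mul, hx, Matrix.mul_smul, Matrix.mul_smul,
    mul_vecMulVec, mulVec_inv_mulVec hA, vecMulVec_mul_vecMulVec]
  ext i j
  simp only [Matrix.add_apply, Matrix.sub_apply, Matrix.smul_apply, vecMulVec_apply, smul_eq_mul,
    Pi.smul_apply]
  field_simp
  ring

theorem dotProduct_inv_rankOne (hA : A.PosDef) (x S : n → ℝ) (c : ℝ) :
    (S + c • x) ⬝ᵥ (A + vecMulVec x x)⁻¹ *ᵥ (S + c • x)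
      = S ⬝ᵥ A⁻¹ *ᵥ S - (x ⬝ᵥ A⁻¹ *ᵥ S) ^ 2 / (1 + x ⬝ᵥ A⁻¹ *ᵥ x)
        + 2 * c * (x ⬝ᵥ A⁻¹ *ᵥ S) / (1 + x ⬝ᵥ A⁻¹ *ᵥ x)
        + c ^ 2 * (x ⬝ᵥ A⁻¹ *ᵥ x) / (1 + x ⬝ᵥ A⁻¹ *ᵥ x) := by
  have hq := dotProduct_mulVec_nonneg hA.inv x
  have e : ∀ v : n → ℝ, v ⬝ᵥ (A + vecMulVec x x)⁻¹ *ᵥ v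
      = v ⬝ᵥ A⁻¹ *ᵥ v - (x ⬝ᵥ A⁻¹ *ᵥ v) ^ 2 / (1 + x ⬝ᵥ A⁻¹ *ᵥ x) := by
    intro v
    rw [add_vecMulVec_inv hA, sub_mulVec, smul_mulVec, vecMulVec_mulVec, dotProduct_sub,
      dotProduct_smul, dotProduct_mulVec_symm hA.inv x v]
    simp only [op_smul_eq_smul, dotProduct_smul, smul_eq_mul]
    rw [dotProduct_comm (A⁻¹ *ᵥ x) v]
    field_simp
  rw [e]
  simp only [mulVec_add, mulVec_smul, dotProduct_add, add_dotProduct, dotProduct_smul,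
      smul_dotProduct, smul_eq_mul]
  rw [dotProduct_mulVec_symm hA.inv S x]
  field_simp
  ring

theorem det_add_vecMulVec (hA : A.PosDef) (x : n → ℝ) :
    (A + vecMulVec x x).det = A.det * (1 + x ⬝ᵥ A⁻¹ *ᵥ x) := by
  rw [vecMulVec_eq Unit, det_add_replicateCol_mul_replicateRow
    ((isUnit_iff_isUnit_det A).1 hA.isUnit)]
  congr 1
  rw [Matrix.mul_assoc, replicateCol, det_unique]
  simp [Matrix.mul_apply, dotProduct, mulVec, replicateRow]

/-- Cauchy-Schwarz in the updated matrix: the update adds `(x ⬝ᵥ y)²` to the quadratic form, which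
improves the factor from `q` to `q / (1 + q)`. This is what lets a single outlier be charged only
its leverage. -/
theorem dotProduct_sq_le_rankOne (hA : A.PosDef) (x y : n → ℝ) :
    (x ⬝ᵥ y) ^ 2 ≤ (x ⬝ᵥ A⁻¹ *ᵥ x) / (1 + x ⬝ᵥ A⁻¹ *ᵥ x) * (y ⬝ᵥ (A + vecMulVec x x) *ᵥ y) := by
  have hq := dotProduct_mulVec_nonneg hA.inv x
  have h := dotProduct_sq_le hA x y
  have e : y ⬝ᵥ (A + vecMulVec x x) *ᵥ y = y ⬝ᵥ A *ᵥ y + (x ⬝ᵥ y) ^ 2 := by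
    rw [add_mulVec, dotProduct_add, vecMulVec_mulVec]
    simp [dotProduct_comm y x, pow_two]
  rw [e, div_mul_eq_mul_div, le_div_iff₀ (by positivity)]
  linarith

/-- Jensen's inequality for the logarithm of the eigenvalues (AM-GM). -/
theorem log_det_le (hA : A.PosDef) [Nonempty n] :
    Real.log A.det ≤ Fintype.card n * Real.log (A.trace / Fintype.card n) := by
  have hpos := hA.eigenvalues_pos
  have hn : (0 : ℝ) < Fintype.card n := by exact_mod_cast Fintype.card_pos
  have h1 := hA.isHermitian.det_eq_prod_eigenvalues
  have h2 := hA.isHermitian.trace_eq_sum_eigenvalues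
  simp only [RCLike.ofReal_real_eq_id, id_eq] at h1 h2
  rw [h1, h2, Real.log_prod (fun i _ => (hpos i).ne')]
  have h3 := strictConcaveOn_log_Ioi.concaveOn.le_map_sum (t := Finset.univ)
    (w := fun _ : n => (Fintype.card n : ℝ)⁻¹) (p := hA.isHermitian.eigenvalues)
    (fun _ _ => by positivity) (by simp [hn.ne']) (fun i _ => hpos i)
  simp only [smul_eq_mul, ← Finset.mul_sum] at h3
  rw [inv_mul_le_iff₀ hn, ← div_eq_inv_mul] at h3
  exact h3

end RankOne

/-! ### The elliptical potential. -/

section Potential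

variable {d : ℕ} {H : ℕ → Matrix (Fin d) (Fin d) ℝ} {X : ℕ → Fin d → ℝ} {lam : ℝ}

theorem posDef_of_rankOne_updates (hlam : 0 < lam) (h0 : H 0 = lam • 1)
    (hs : ∀ s, H (s + 1) = H s + vecMulVec (X s) (X s)) (s : ℕ) : (H s).PosDef := by
  induction s with
  | zero => rw [h0]; exact PosDef.one.smul hlam
  | succ s ih => rw [hs]; exact posDef_add_vecMulVec ih _

theorem dotProduct_mulVec_eq_sum (h0 : H 0 = lam • 1)
    (hs : ∀ s, H (s + 1) = H s + vecMulVec (X s) (X s)) (t : ℕ) (v : Fin d → ℝ) :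
    v ⬝ᵥ H t *ᵥ v = lam * (v ⬝ᵥ v) + ∑ s ∈ Finset.range t, (X s ⬝ᵥ v) ^ 2 := by
  induction t with
  | zero => simp [h0, smul_mulVec]
  | succ t ih =>
    rw [hs, add_mulVec, dotProduct_add, ih, vecMulVec_mulVec, Finset.sum_range_succ]
    simp [dotProduct_comm v (X t), pow_two, add_assoc]

theorem dotProduct_sq_le_of_lt (hlam : 0 < lam) (h0 : H 0 = lam • 1)
    (hs : ∀ s, H (s + 1) = H s + vecMulVec (X s) (X s)) {s t : ℕ} (hst : s < t)
    (v : Fin d → ℝ) :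
    (X s ⬝ᵥ v) ^ 2 ≤ (X s ⬝ᵥ (H s)⁻¹ *ᵥ X s) / (1 + X s ⬝ᵥ (H s)⁻¹ *ᵥ X s)
      * (v ⬝ᵥ H t *ᵥ v) := by
  have hq := dotProduct_mulVec_nonneg (posDef_of_rankOne_updates hlam h0 hs s).inv (X s)
  have h := dotProduct_sq_le_rankOne (posDef_of_rankOne_updates hlam h0 hs s) (X s) v
  rw [← hs] at h
  refine h.trans (mul_le_mul_of_nonneg_left ?_ (by positivity))
  rw [dotProduct_mulVec_eq_sum h0 hs, dotProduct_mulVec_eq_sum h0 hs]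
  gcongr
  exact hst

/-- The elliptical potential lemma. -/
theorem sum_div_one_add_le (hd : 1 ≤ d) (hlam : 0 < lam) (h0 : H 0 = lam • 1)
    (hs : ∀ s, H (s + 1) = H s + vecMulVec (X s) (X s)) {M : ℝ}
    (T : ℕ) (hX : ∀ s < T, X s ⬝ᵥ X s ≤ M) :
    ∑ s ∈ Finset.range T, (X s ⬝ᵥ (H s)⁻¹ *ᵥ X s) / (1 + X s ⬝ᵥ (H s)⁻¹ *ᵥ X s)
      ≤ d * Real.log (1 + T * M / (d * lam)) := by
  have hpd := posDef_of_rankOne_updates hlam h0 hs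
  have : Nonempty (Fin d) := ⟨⟨0, hd⟩⟩
  have hd' : (0 : ℝ) < d := by exact_mod_cast hd
  -- Each update multiplies the determinant by `1 + q`, and `q / (1 + q) ≤ log (1 + q)`, so the sum
  -- telescopes. No upper bound on `q` is needed.
  have hdet : ∀ t, ∑ s ∈ Finset.range t,
      (X s ⬝ᵥ (H s)⁻¹ *ᵥ X s) / (1 + X s ⬝ᵥ (H s)⁻¹ *ᵥ X s)
      ≤ Real.log (H t).det - Real.log (H 0).det := by
    intro t
    induction t with
    | zero => simp
    | succ t ih =>
      have hq := dotProduct_mulVec_nonneg (hpd t).inv (X t)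
      have h1 : (0 : ℝ) < 1 + X t ⬝ᵥ (H t)⁻¹ *ᵥ X t := by positivity
      rw [Finset.sum_range_succ, hs, det_add_vecMulVec (hpd t),
        Real.log_mul (hpd t).det_pos.ne' h1.ne']
      have := Real.one_sub_inv_le_log_of_pos h1
      have e : 1 - (1 + X t ⬝ᵥ (H t)⁻¹ *ᵥ X t)⁻¹
        = (X t ⬝ᵥ (H t)⁻¹ *ᵥ X t) / (1 + X t ⬝ᵥ (H t)⁻¹ *ᵥ X t) := by
        field_simp; ring
      linarith
  have htr : ∀ t ≤ T, (H t).trace ≤ d * lam + t * M := by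
    intro t ht
    induction t with
    | zero => simp [h0, trace_smul, mul_comm]
    | succ t ih =>
      rw [hs, trace_add, trace_vecMulVec]
      have h1 := ih (by omega)
      have h2 := hX t (by omega)
      push_cast
      linarith
  have hdet0 : Real.log (H 0).det = d * Real.log lam := by
    rw [h0, det_smul, det_one, mul_one, Fintype.card_fin, Real.log_pow]
  have htrpos : 0 < (H T).trace := (hpd T).trace_pos
  calc _ ≤ _ := hdet T
    _ ≤ d * Real.log ((H T).trace / d) - d * Real.log lam := by
        have := log_det_le (hpd T)
        rw [Fintype.card_fin] at this
        linarith
    _ = d * Real.log ((H T).trace / d / lam) := by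
        rw [Real.log_div (by positivity) hlam.ne']; ring
    _ ≤ _ := by
        gcongr
        have := htr T le_rfl
        rw [div_div, div_le_iff₀ (by positivity)]
        have e : (1 + T * M / (d * lam)) * (d * lam) = d * lam + T * M := by
          field_simp
        rwa [e]

end Potential

end AdaOFUL

/-! ### The pseudo-Huber loss and one-step exponential bounds. -/

namespace AdaOFUL

/-- The derivative `ℓ_τ'(x)` of the pseudo-Huber loss. -/
noncomputable def huberScore (τ x : ℝ) : ℝ := τ * x / Real.sqrt (τ ^ 2 + x ^ 2)

theorem huberScore_sq_le (τ x : ℝ) : huberScore τ x ^ 2 ≤ x ^ 2 := by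
  rcases eq_or_ne τ 0 with rfl | hτ
  · simpa [huberScore] using sq_nonneg x
  · have : 0 < τ ^ 2 := by positivity
    rw [huberScore, div_pow, Real.sq_sqrt (by positivity), div_le_iff₀ (by positivity)]
    nlinarith [sq_nonneg (x ^ 2)]

theorem huberScore_sq_le_left (τ x : ℝ) : huberScore τ x ^ 2 ≤ τ ^ 2 := by
  rcases eq_or_ne τ 0 with rfl | hτ
  · simp [huberScore]
  · have : 0 < τ ^ 2 := by positivity
    rw [huberScore, div_pow, Real.sq_sqrt (by positivity), div_le_iff₀ (by positivity)]
    nlinarith [sq_nonneg (τ ^ 2)]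

/-- Bounds the bias of the score against the raw noise. It is quadratic in the noise, so a
conditional second moment suffices to control it. -/
theorem abs_sub_huberScore_le {τ : ℝ} (hτ : 0 < τ) (x : ℝ) :
    |x - huberScore τ x| ≤ x ^ 2 / τ := by
  have hA : 0 < Real.sqrt (τ ^ 2 + x ^ 2) := by positivity
  have hA2 := Real.sq_sqrt (show 0 ≤ τ ^ 2 + x ^ 2 by positivity)
  set A := Real.sqrt (τ ^ 2 + x ^ 2)
  have hle : A ≤ τ + |x| :=
    abs_le_of_sq_le_sq' (by nlinarith [abs_nonneg x, sq_abs x]) (by positivity) |>.2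
  have hτA : τ ≤ A := abs_le_of_sq_le_sq' (by nlinarith [sq_nonneg x]) hA.le |>.2
  have e : x - huberScore τ x = x * ((A - τ) / A) := by
    rw [huberScore]; change x - τ * x / A = _; field_simp
  rw [e, abs_mul, abs_of_nonneg (div_nonneg (by linarith) hA.le), ← sq_abs x, pow_two,
    mul_div_assoc]
  gcongr
  linarith

/-- The Bregman divergence of the pseudo-Huber loss in closed form. -/
theorem pseudoHuber_sub_eq {τ : ℝ} (hτ : 0 < τ) (x y : ℝ) :
    pseudoHuber τ x - pseudoHuber τ y - huberScore τ y * (x - y)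
      = τ ^ 3 * (x - y) ^ 2 / (Real.sqrt (τ ^ 2 + y ^ 2)
        * (Real.sqrt (τ ^ 2 + x ^ 2) * Real.sqrt (τ ^ 2 + y ^ 2) + τ ^ 2 + x * y)) ∧
    0 < Real.sqrt (τ ^ 2 + x ^ 2) * Real.sqrt (τ ^ 2 + y ^ 2) + τ ^ 2 + x * y ∧
    τ ^ 2 + x * y ≤ Real.sqrt (τ ^ 2 + x ^ 2) * Real.sqrt (τ ^ 2 + y ^ 2) := by
  have hA : 0 < Real.sqrt (τ ^ 2 + x ^ 2) := by positivity
  have hB : 0 < Real.sqrt (τ ^ 2 + y ^ 2) := by positivity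
  have hA2 := Real.sq_sqrt (show 0 ≤ τ ^ 2 + x ^ 2 by positivity)
  have hB2 := Real.sq_sqrt (show 0 ≤ τ ^ 2 + y ^ 2 by positivity)
  unfold pseudoHuber huberScore
  set A := Real.sqrt (τ ^ 2 + x ^ 2)
  set B := Real.sqrt (τ ^ 2 + y ^ 2)
  -- Lagrange's identity for the plane vectors `(τ, x)` and `(τ, y)`.
  have hAB : (A * B) ^ 2 = (τ ^ 2 + x * y) ^ 2 + τ ^ 2 * (x - y) ^ 2 := by
    rw [mul_pow, hA2, hB2]; ring
  have hle : |τ ^ 2 + x * y| ≤ A * B :=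
    abs_le_of_sq_le_sq (by nlinarith [mul_nonneg (sq_nonneg τ) (sq_nonneg (x - y))]) (by positivity)
  have hpos : 0 < A * B + τ ^ 2 + x * y := by
    rcases eq_or_ne x y with rfl | hxy
    · have := mul_pos hA hB; nlinarith [mul_self_nonneg x, pow_pos hτ 2]
    · have h1 : 0 < (x - y) ^ 2 := by have := sub_ne_zero.2 hxy; positivity
      have h2 : |τ ^ 2 + x * y| < A * B :=
        abs_lt_of_sq_lt_sq (by nlinarith [mul_pos (pow_pos hτ 2) h1]) (by positivity)
      linarith [neg_abs_le (τ ^ 2 + x * y)]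
  refine ⟨?_, hpos, (le_abs_self _).trans hle⟩
  rw [eq_div_iff (by positivity)]
  have e : (τ * (A - τ) - τ * (B - τ) - τ * y / B * (x - y)) * (B * (A * B + τ ^ 2 + x * y))
      = τ * ((A * B - B ^ 2 - y * (x - y)) * (A * B + τ ^ 2 + x * y)) := by
    field_simp
    ring
  rw [e, hB2]
  linear_combination τ * hAB

theorem pseudoHuber_ge {τ : ℝ} (hτ : 0 ≤ τ) (x y : ℝ) :
    pseudoHuber τ y + huberScore τ y * (x - y) ≤ pseudoHuber τ x := by
  rcases hτ.eq_or_lt with rfl | hτ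
  · simp [pseudoHuber, huberScore]
  · obtain ⟨h1, h2, -⟩ := pseudoHuber_sub_eq hτ x y
    have : 0 ≤ pseudoHuber τ x - pseudoHuber τ y - huberScore τ y * (x - y) := by
      rw [h1]; positivity
    linarith

/-- In the closed form of the Bregman divergence the denominator is at most `2 A B²`, with `A ≤ 1.21
τ` and `B² ≤ 1.25 τ²`, so the factor of `(x - y)²` is at least `1 / 3.025 > 3 / 10`. -/
theorem pseudoHuber_ge_quadratic {τ : ℝ} (hτ : 0 < τ) {x y : ℝ} (hy : |y| ≤ τ / 2)
    (hxy : |x - y| ≤ τ / 6) :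
    pseudoHuber τ y + huberScore τ y * (x - y) + 3 / 10 * (x - y) ^ 2 ≤ pseudoHuber τ x := by
  obtain ⟨h1, h2, h3⟩ := pseudoHuber_sub_eq hτ x y
  suffices h : 3 / 10 * (x - y) ^ 2
      ≤ pseudoHuber τ x - pseudoHuber τ y - huberScore τ y * (x - y) by linarith
  rw [h1]
  have hB : 0 < Real.sqrt (τ ^ 2 + y ^ 2) := by positivity
  have hB2 := Real.sq_sqrt (show 0 ≤ τ ^ 2 + y ^ 2 by positivity)
  have hx : |x| ≤ 2 / 3 * τ := by
    have := abs_add_le (x - y) y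
    rw [sub_add_cancel] at this
    linarith
  have hA' : Real.sqrt (τ ^ 2 + x ^ 2) ≤ 121 / 100 * τ := by
    rw [Real.sqrt_le_left (by positivity)]
    have := abs_le.1 hx
    nlinarith
  have hB' : τ ^ 2 + y ^ 2 ≤ 5 / 4 * τ ^ 2 := by
    have := abs_le.1 hy
    nlinarith
  set A := Real.sqrt (τ ^ 2 + x ^ 2)
  set B := Real.sqrt (τ ^ 2 + y ^ 2)
  rw [le_div_iff₀ (by positivity)]
  have : 3 / 10 * (B * (A * B + τ ^ 2 + x * y)) ≤ τ ^ 3 := by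
    calc 3 / 10 * (B * (A * B + τ ^ 2 + x * y)) ≤ 3 / 10 * (B * (A * B + A * B)) := by
          exact mul_le_mul_of_nonneg_left
            (mul_le_mul_of_nonneg_left (by linarith) hB.le) (by norm_num)
      _ = 3 / 5 * (A * B ^ 2) := by ring
      _ ≤ 3 / 5 * (121 / 100 * τ * (5 / 4 * τ ^ 2)) := by rw [hB2]; gcongr
      _ ≤ τ ^ 3 := by nlinarith [pow_pos hτ 3]
  nlinarith [sq_nonneg (x - y)]

/-- A quadratic majorant, linear up to a multiple of `z²`, of the exponential of one increment of
the self-normalized process. -/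
theorem exp_increment_le {τ₀ β η w a z : ℝ} (hτ₀ : 0 < τ₀) (hβ : τ₀ ≤ β) (hη : 0 ≤ η)
    (hη1 : η * (3 * τ₀ * β) ≤ 1) (hw : 0 ≤ w) (ha : |a| ≤ w * β) {τ : ℝ}
    (hτ : τ = τ₀ * Real.sqrt (1 + w ^ 2) / w) {U : ℝ}
    (hU : U = η * (2 * huberScore τ z * a / (1 + w ^ 2)
      + huberScore τ z ^ 2 * w ^ 2 / (1 + w ^ 2))) :
    U ≤ 1 ∧ Real.exp U ≤ 1 + η * (2 * a / (1 + w ^ 2)) * z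
      + w ^ 2 / (1 + w ^ 2) * (η * (2 * β / τ₀ + 1) + 9 * η ^ 2 * β ^ 2) * z ^ 2 := by
  rcases hw.eq_or_lt with rfl | hw
  -- For `w = 0` the quotient defining `τ` takes the default value `0`, but both terms of `U`
  -- vanish.
  · have ha0 : a = 0 := by simpa using ha
    have hU0 : U = 0 := by simp [hU, ha0]
    simp [hU0, ha0]
  have hβ0 : 0 < β := by linarith
  set D := 1 + w ^ 2 with hD
  have hD0 : 0 < D := by positivity
  have hR : 0 < Real.sqrt D := by positivity
  have hR2 : Real.sqrt D ^ 2 = D := Real.sq_sqrt hD0.le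
  set R := Real.sqrt D
  have hR1 : 1 ≤ R := by
    have : (1:ℝ) ≤ D := by rw [hD]; nlinarith [sq_nonneg w]
    exact Real.one_le_sqrt.2 this
  have hwR : w ≤ R := abs_le_of_sq_le_sq' (by rw [hR2, hD]; linarith) hR.le |>.2
  have hτ0 : 0 < τ := by rw [hτ]; positivity
  -- The reason for the form of `τ`: a clipped score times `w` is at most `τ₀ √(1 + w²)`, whatever
  -- `w` is.
  have hτw : τ * w = τ₀ * R := by rw [hτ]; field_simp
  set ψ := huberScore τ z
  have hψτ : |ψ| ≤ τ := abs_le_of_sq_le_sq (huberScore_sq_le_left τ z) hτ0.le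
  have hψz : ψ ^ 2 ≤ z ^ 2 := huberScore_sq_le τ z
  have hψw : |ψ| * w ≤ τ₀ * R := by rw [← hτw]; gcongr
  have hsum : |2 * a + ψ * w ^ 2| ≤ 3 * β * w * R := by
    calc |2 * a + ψ * w ^ 2| ≤ |2 * a| + |ψ * w ^ 2| := abs_add_le _ _
      _ = 2 * |a| + (|ψ| * w) * w := by
          rw [abs_mul, abs_mul, abs_of_pos (two_pos : (0:ℝ) < 2), abs_of_pos (pow_pos hw 2)]; ring
      _ ≤ 2 * (w * β) + (τ₀ * R) * w := by gcongr
      _ ≤ 2 * (w * β * R) + (β * R) * w := by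
          have h1 : w * β ≤ w * β * R := le_mul_of_one_le_right (by positivity) hR1
          have h2 : (τ₀ * R) * w ≤ (β * R) * w := by gcongr
          linarith
      _ = _ := by ring
  have hUe : U = η * (ψ * (2 * a + ψ * w ^ 2) / D) := by rw [hU]; ring
  have hYabs : |ψ * (2 * a + ψ * w ^ 2) / D| ≤ 3 * τ₀ * β := by
    rw [abs_div, abs_mul, abs_of_pos hD0, div_le_iff₀ hD0]
    calc |ψ| * |2 * a + ψ * w ^ 2| ≤ |ψ| * (3 * β * w * R) := by gcongr
      _ = 3 * β * R * (|ψ| * w) := by ring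
      _ ≤ 3 * β * R * (τ₀ * R) := by gcongr
      _ = 3 * τ₀ * β * D := by rw [← hR2]; ring
  have hU1 : |U| ≤ 1 := by
    rw [hUe, abs_mul, abs_of_nonneg hη]
    exact (mul_le_mul_of_nonneg_left hYabs hη).trans hη1
  -- `exp U ≤ 1 + U + U²` for `|U| ≤ 1`. It remains to replace the score by `z` in the linear term,
  -- at the price of the bias, and to bound the square.
  have hexp := (abs_le.1 (Real.abs_exp_sub_one_sub_id_le hU1)).2
  refine ⟨(abs_le.1 hU1).2, ?_⟩
  have hlin : ψ * (2 * a) / D ≤ 2 * a / D * z + w ^ 2 / D * (2 * β / τ₀) * z ^ 2 := by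
    have h1 : (ψ - z) * (2 * a) ≤ (z ^ 2 / τ) * (2 * (w * β)) := by
      calc (ψ - z) * (2 * a) ≤ |(ψ - z) * (2 * a)| := le_abs_self _
        _ = |z - ψ| * (2 * |a|) := by
            rw [abs_mul, abs_mul, abs_sub_comm, abs_of_pos (two_pos : (0:ℝ) < 2)]
        _ ≤ _ := by
            have := abs_sub_huberScore_le hτ0 z
            gcongr
    have h2 : (z ^ 2 / τ) * (2 * (w * β)) ≤ w ^ 2 * (2 * β / τ₀) * z ^ 2 := by
      have : w / τ ≤ w ^ 2 / τ₀ := by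
        rw [div_le_div_iff₀ hτ0 hτ₀, pow_two, mul_assoc, mul_comm w τ, hτw]
        nlinarith [mul_pos hw hτ₀]
      calc (z ^ 2 / τ) * (2 * (w * β)) = (w / τ) * (2 * β * z ^ 2) := by ring
        _ ≤ (w ^ 2 / τ₀) * (2 * β * z ^ 2) := by gcongr
        _ = _ := by ring
    have e : 2 * a / D * z + w ^ 2 / D * (2 * β / τ₀) * z ^ 2
        = (2 * a * z + w ^ 2 * (2 * β / τ₀) * z ^ 2) / D := by ring
    rw [e]
    gcongr
    linarith
  have hquad : ψ ^ 2 * w ^ 2 / D ≤ w ^ 2 / D * z ^ 2 := by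
    rw [mul_comm, mul_div_right_comm]; gcongr
  have hsq : (ψ * (2 * a + ψ * w ^ 2) / D) ^ 2 ≤ w ^ 2 / D * (9 * β ^ 2) * z ^ 2 := by
    rw [div_pow, mul_pow, div_le_iff₀ (by positivity)]
    have h1 : (2 * a + ψ * w ^ 2) ^ 2 ≤ (3 * β * w * R) ^ 2 := sq_le_sq.2 (by
      rwa [abs_of_nonneg (show 0 ≤ 3 * β * w * R by positivity)])
    calc ψ ^ 2 * (2 * a + ψ * w ^ 2) ^ 2 ≤ z ^ 2 * (3 * β * w * R) ^ 2 := by gcongr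
      _ = z ^ 2 * (9 * β ^ 2 * w ^ 2 * R ^ 2) := by ring
      _ = w ^ 2 / D * (9 * β ^ 2) * z ^ 2 * D ^ 2 := by rw [hR2]; field_simp
  have hY : ψ * (2 * a + ψ * w ^ 2) / D = ψ * (2 * a) / D + ψ ^ 2 * w ^ 2 / D := by ring
  calc Real.exp U ≤ 1 + U + U ^ 2 := by linarith
    _ = 1 + η * (ψ * (2 * a) / D + ψ ^ 2 * w ^ 2 / D)
        + η ^ 2 * (ψ * (2 * a + ψ * w ^ 2) / D) ^ 2 := by rw [hUe, hY]; ring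
    _ ≤ 1 + η * ((2 * a / D * z + w ^ 2 / D * (2 * β / τ₀) * z ^ 2) + w ^ 2 / D * z ^ 2)
        + η ^ 2 * (w ^ 2 / D * (9 * β ^ 2) * z ^ 2) := by gcongr
    _ = _ := by ring

/-- Chebyshev's inequality before taking expectations: on the event `1 ≤ 4 z² / τ²`, and `τ² r =
τ₀²` for `r = w² / (1 + w²)` turns this into `r ≤ 4 r² z² / τ₀²`. The remaining factor `2` comes
from `exp u ≤ 1 + 2 u` on `[0, 1]`. -/
theorem exp_indicator_le {τ₀ w z η : ℝ} (hτ₀ : 0 < τ₀) (hw : 0 ≤ w) {τ : ℝ}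
    (hτ : τ = τ₀ * Real.sqrt (1 + w ^ 2) / w) (hη : 0 ≤ η)
    (hηw : η * (w ^ 2 / (1 + w ^ 2)) ≤ 1) :
    (if τ / 2 < |z| then η * (w ^ 2 / (1 + w ^ 2)) else 0) ≤ 1 ∧
    Real.exp (if τ / 2 < |z| then η * (w ^ 2 / (1 + w ^ 2)) else 0)
      ≤ 1 + 8 * η / τ₀ ^ 2 * (w ^ 2 / (1 + w ^ 2)) ^ 2 * z ^ 2 := by
  set r := w ^ 2 / (1 + w ^ 2) with hr
  have hr0 : 0 ≤ r := by positivity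
  split_ifs with h
  · refine ⟨hηw, ?_⟩
    have hexp := (abs_le.1 (Real.abs_exp_sub_one_sub_id_le (x := η * r)
      (by rwa [abs_of_nonneg (by positivity)]))).2
    have h1 : η * r ≤ 4 * η / τ₀ ^ 2 * r ^ 2 * z ^ 2 := by
      rcases hw.eq_or_lt with rfl | hw
      · simp [hr]
      have hz : τ ^ 2 / 4 ≤ z ^ 2 := by
        have : 0 < τ := by rw [hτ]; positivity
        rw [← sq_abs z]; nlinarith
      have hτr : τ ^ 2 * r = τ₀ ^ 2 := by
        rw [hτ, hr, div_pow, mul_pow, Real.sq_sqrt (by positivity)]; field_simp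
      calc η * r = 4 * η / τ₀ ^ 2 * r * (τ ^ 2 * r) / 4 := by rw [hτr]; field_simp
        _ = 4 * η / τ₀ ^ 2 * r ^ 2 * (τ ^ 2 / 4) := by ring
        _ ≤ _ := by gcongr
    have h2 : (η * r) ^ 2 ≤ η * r := by
      rw [pow_two]; exact mul_le_of_le_one_left (by positivity) hηw
    calc Real.exp (η * r) ≤ 1 + 2 * (η * r) := by linarith
      _ ≤ 1 + 2 * (4 * η / τ₀ ^ 2 * r ^ 2 * z ^ 2) := by gcongr
      _ = _ := by ring
  · refine ⟨zero_le_one, ?_⟩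
    rw [Real.exp_zero]
    have : 0 ≤ 8 * η / τ₀ ^ 2 * r ^ 2 * z ^ 2 := by positivity
    linarith

/-- The self-bounding inequality that closes the induction on the self-normalized process. -/
theorem radius_bound {κ τ₀ ℓ β G : ℝ} (hκ : 0 ≤ κ) (hτ₀ : 0 < τ₀) (hℓ : Real.log 2 ≤ ℓ)
    (hβ : β = 7 * (κ / τ₀ + Real.sqrt (κ * ℓ) + τ₀ * ℓ)) (hG : G = τ₀ + Real.sqrt (κ / ℓ)) :
    0 < G ∧ τ₀ ≤ β ∧
    2 * β * κ / τ₀ + κ + 3 * β * κ / G + 3 * β * G * ℓ ≤ β ^ 2 := by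
  have hl2 : (0.69 : ℝ) < Real.log 2 := by linarith [Real.log_two_gt_d9]
  have hℓ0 : 0 < ℓ := by linarith
  have hGpos : 0 < G := by rw [hG]; positivity
  have hg1 : 0 ≤ κ / τ₀ := by positivity
  have hg3 : 0 < τ₀ * ℓ := by positivity
  set q := Real.sqrt (κ * ℓ) with hq
  have hq0 : 0 ≤ q := Real.sqrt_nonneg _
  have hq2 : q ^ 2 = κ * ℓ := Real.sq_sqrt (by positivity)
  have hβpos : 0 < β := by rw [hβ]; positivity
  have hp : Real.sqrt (κ / ℓ) = q / ℓ := by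
    rw [hq, eq_div_iff hℓ0.ne', ← Real.sqrt_sq hℓ0.le, ← Real.sqrt_mul (by positivity),
      Real.sqrt_sq hℓ0.le]
    congr 1; field_simp
  refine ⟨hGpos, ?_, ?_⟩
  · rw [hβ]; nlinarith [mul_pos hτ₀ hℓ0]
  have h1 : κ / G ≤ q := by
    rw [div_le_iff₀ hGpos, hG, hp]
    have : q * (q / ℓ) = κ := by rw [← mul_div_assoc, ← pow_two, hq2]; field_simp
    nlinarith [mul_nonneg hq0 hτ₀.le]
  have h2 : G * ℓ = τ₀ * ℓ + q := by rw [hG, hp]; field_simp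
  -- The right side contains multiples of `κ / τ₀ * (τ₀ * ℓ) = κ ℓ`, and `ℓ ≥ log 2` is bounded
  -- below.
  have h3 : κ ≤ β * (κ / τ₀ + q + τ₀ * ℓ) := by
    have e : κ / τ₀ * (τ₀ * ℓ) = κ * ℓ := by field_simp
    have : κ * 0.69 ≤ κ * ℓ := by gcongr; linarith
    rw [hβ]
    nlinarith [mul_nonneg hg1 hq0, mul_nonneg hq0 hg3.le, mul_nonneg hg1 hg1, mul_nonneg hg3.le hg3.le]
  have h4 : β ^ 2 = 7 * β * (κ / τ₀ + q + τ₀ * ℓ) := by rw [pow_two]; nth_rw 1 [hβ]; ring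
  have e1 : 2 * β * κ / τ₀ = β * (2 * (κ / τ₀)) := by ring
  have e2 : 3 * β * κ / G = β * (3 * (κ / G)) := by ring
  have e3 : 3 * β * G * ℓ = β * (3 * (τ₀ * ℓ + q)) := by rw [← h2]; ring
  have h5 : β * (3 * (κ / G)) ≤ β * (3 * q) := by gcongr
  rw [h4, e1, e2, e3]
  -- The constant `7` is the coefficient of `β q`: one from `h3`, three from `κ / G ≤ q`, three from
  -- `G ℓ = τ₀ ℓ + q`. In `G`, the summand `√(κ / ℓ)` balances `κ / G` against `G ℓ`, and `τ₀` keeps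
  -- the exponents at most `1`.
  nlinarith [mul_nonneg hβpos.le hg1, mul_nonneg hβpos.le hq0, mul_nonneg hβpos.le hg3.le]

end AdaOFUL

/-! ### Conditional second moments and exponential supermartingales. -/

namespace AdaOFUL

open scoped ENNReal

variable {Ω : Type*} {m mΩ : MeasurableSpace Ω} {μ : Measure Ω}

/-- Pull-out property of the `[0, ∞]`-valued conditional expectation, in integrated form. -/
theorem lintegral_mul_condLExp (hm : m ≤ mΩ) [SigmaFinite (μ.trim hm)] {g Y : Ω → ℝ≥0∞}
    (hg : Measurable[m] g) (hY : Measurable Y) :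
    ∫⁻ ω, g ω * condLExp m μ Y ω ∂μ = ∫⁻ ω, g ω * Y ω ∂μ := by
  -- The measures with densities `Y` and its conditional expectation agree on `m`, and the integral
  -- of an `m`-measurable function sees nothing else.
  have key : (μ.withDensity (condLExp m μ Y)).trim hm = (μ.withDensity Y).trim hm := by
    refine @Measure.ext _ m _ _ fun s hs => ?_
    rw [trim_measurableSet_eq hm hs, trim_measurableSet_eq hm hs, withDensity_apply _ (hm s hs),
      withDensity_apply _ (hm s hs), setLIntegral_condLExp hm _ _ hs]
  have h : ∀ f : Ω → ℝ≥0∞, Measurable f →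
      ∫⁻ ω, g ω * f ω ∂μ = ∫⁻ ω, g ω ∂((μ.withDensity f).trim hm) := by
    intro f hf
    rw [lintegral_trim hm hg, lintegral_withDensity_eq_lintegral_mul _ hf (hg.mono hm le_rfl)]
    simp only [Pi.mul_apply, mul_comm]
  rw [h _ (measurable_condLExp' m μ Y), h _ hY, key]

/-- The noise of a round divided by a predictable scale that dominates its conditional standard
deviation is conditionally centered with conditional second moment at most `1`. -/
theorem lintegral_mul_scaled_sq_le [IsProbabilityMeasure μ] (hm : m ≤ mΩ) {e v σ : Ω → ℝ}
    (he : Measurable e) (hσ : Measurable[m] σ) (hσ0 : ∀ ω, 0 < σ ω) (hv0 : ∀ ω, 0 ≤ v ω)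
    (hv : ∀ ω, v ω ≤ σ ω)
    (hsq : condLExp m μ (fun ω => ENNReal.ofReal (e ω ^ 2))
      =ᵐ[μ] fun ω => ENNReal.ofReal (v ω ^ 2))
    {g : Ω → ℝ≥0∞} (hg : Measurable[m] g) :
    ∫⁻ ω, g ω * ENNReal.ofReal ((e ω / σ ω) ^ 2) ∂μ ≤ ∫⁻ ω, g ω ∂μ := by
  have h1 : ∀ ω, g ω * ENNReal.ofReal ((e ω / σ ω) ^ 2)
      = (g ω * ENNReal.ofReal ((σ ω ^ 2)⁻¹)) * ENNReal.ofReal (e ω ^ 2) := by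
    intro ω
    rw [mul_assoc, ← ENNReal.ofReal_mul (by positivity), div_pow, div_eq_inv_mul]
  have hg' : Measurable[m] fun ω => g ω * ENNReal.ofReal ((σ ω ^ 2)⁻¹) :=
    hg.mul (ENNReal.measurable_ofReal.comp (hσ.pow_const 2).inv)
  simp_rw [h1]
  rw [← lintegral_mul_condLExp (Y := fun ω => ENNReal.ofReal (e ω ^ 2)) hm hg'
    (ENNReal.measurable_ofReal.comp (he.pow_const 2))]
  refine lintegral_mono_ae ?_
  filter_upwards [hsq] with ω hω
  rw [hω, mul_assoc, ← ENNReal.ofReal_mul (by have := hσ0 ω; positivity)]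
  refine mul_le_of_le_one_right' (ENNReal.ofReal_le_one.2 ?_)
  have := hσ0 ω
  rw [inv_mul_le_iff₀ (by positivity), mul_one]
  exact pow_le_pow_left₀ (hv0 ω) (hv ω) 2

/-- The floor `c` makes `1 / σ` bounded, so pulling it out requires only integrability of `e`. -/
theorem condExp_div_eq_zero [IsProbabilityMeasure μ] (hm : m ≤ mΩ) {e σ : Ω → ℝ} {c : ℝ}
    (he : Integrable e μ) (hσ : StronglyMeasurable[m] σ) (hc : 0 < c) (hσc : ∀ ω, c ≤ σ ω)
    (h0 : μ[e | m] =ᵐ[μ] 0) :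
    Integrable (fun ω => e ω / σ ω) μ ∧ μ[fun ω => e ω / σ ω | m] =ᵐ[μ] 0 := by
  have hs : StronglyMeasurable[m] fun ω => (σ ω)⁻¹ := hσ.inv₀
  have hb : ∀ ω, ‖(σ ω)⁻¹‖ ≤ c⁻¹ := fun ω => by
    have := hc.trans_le (hσc ω)
    rw [norm_inv, Real.norm_of_nonneg this.le]
    exact inv_anti₀ hc (hσc ω)
  have e1 : (fun ω => e ω / σ ω) = (fun ω => (σ ω)⁻¹) * e := by
    ext ω; simp [div_eq_inv_mul]
  rw [e1]
  refine ⟨he.bdd_mul (hs.mono hm).aestronglyMeasurable (ae_of_all _ hb), ?_⟩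
  filter_upwards [condExp_stronglyMeasurable_mul_of_bound hm hs he c⁻¹ (ae_of_all _ hb), h0]
    with ω h1 h2
  rw [h1, Pi.mul_apply, h2, Pi.zero_apply, mul_zero]

/-- One step of an exponential supermartingale whose increments are majorized by a quadratic
polynomial in a centered variable `z` of conditional variance at most `1`. -/
theorem integral_mul_exp_le [IsProbabilityMeasure μ] (hm : m ≤ mΩ) {z U b q N : Ω → ℝ}
    {Cb Cq CN : ℝ} (hz : Integrable z μ) (hz0 : μ[z | m] =ᵐ[μ] 0)
    (hz2 : ∀ g : Ω → ℝ≥0∞, Measurable[m] g →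
      ∫⁻ ω, g ω * ENNReal.ofReal (z ω ^ 2) ∂μ ≤ ∫⁻ ω, g ω ∂μ)
    (hb : StronglyMeasurable[m] b) (hbC : ∀ ω, |b ω| ≤ Cb)
    (hq : StronglyMeasurable[m] q) (hq0 : ∀ ω, 0 ≤ q ω) (hqC : ∀ ω, q ω ≤ Cq)
    (hN : StronglyMeasurable[m] N) (hN0 : ∀ ω, 0 ≤ N ω) (hNC : ∀ ω, N ω ≤ CN)
    (hU : AEStronglyMeasurable U μ) (hU1 : ∀ ω, U ω ≤ 1)
    (hexp : ∀ ω, Real.exp (U ω) ≤ 1 + b ω * z ω + q ω * z ω ^ 2) :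
    ∫ ω, N ω * Real.exp (U ω - q ω) ∂μ ≤ ∫ ω, N ω ∂μ := by
  -- With the compensator absorbed into the predictable weight `M`, the claim becomes `E[M (1 + b z
  -- + q z²)] ≤ E[M (1 + q)] ≤ E[M exp q] = E[N]`.
  set M : Ω → ℝ := fun ω => N ω * Real.exp (-q ω) with hMdef
  have hM : StronglyMeasurable[m] M := hN.mul (Real.continuous_exp.comp_stronglyMeasurable hq.neg)
  have hM0 : ∀ ω, 0 ≤ M ω := fun ω => mul_nonneg (hN0 ω) (Real.exp_pos _).le
  have hMC : ∀ ω, M ω ≤ CN := fun ω =>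
    (mul_le_of_le_one_right (hN0 ω) (Real.exp_le_one_iff.2 (by linarith [hq0 ω]))).trans (hNC ω)
  have hMm := (hM.mono hm).aestronglyMeasurable (μ := μ)
  have hqm := (hq.mono hm).aestronglyMeasurable (μ := μ)
  have iM : Integrable M μ := .of_bound hMm CN (ae_of_all _ fun ω => by
    rw [Real.norm_of_nonneg (hM0 ω)]; exact hMC ω)
  have iMq : Integrable (fun ω => M ω * q ω) μ := .of_bound (hMm.mul hqm) (CN * Cq)
    (ae_of_all _ fun ω => by
      rw [Real.norm_of_nonneg (mul_nonneg (hM0 ω) (hq0 ω))]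
      exact mul_le_mul (hMC ω) (hqC ω) (hq0 ω) ((hM0 ω).trans (hMC ω)))
  have iMU : Integrable (fun ω => M ω * Real.exp (U ω)) μ :=
    .of_bound (hMm.mul (Real.continuous_exp.comp_aestronglyMeasurable hU)) (CN * Real.exp 1)
    (ae_of_all _ fun ω => by
      rw [Real.norm_of_nonneg (mul_nonneg (hM0 ω) (Real.exp_pos _).le)]
      exact mul_le_mul (hMC ω) (Real.exp_le_exp.2 (hU1 ω)) (Real.exp_pos _).le
        ((hM0 ω).trans (hMC ω)))
  have hMb : StronglyMeasurable[m] fun ω => M ω * b ω := hM.mul hb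
  have hMbC : ∀ᵐ ω ∂μ, ‖M ω * b ω‖ ≤ CN * Cb := ae_of_all _ fun ω => by
    rw [norm_mul, Real.norm_of_nonneg (hM0 ω)]
    exact mul_le_mul (hMC ω) (hbC ω) (norm_nonneg _) ((hM0 ω).trans (hMC ω))
  have iMbz : Integrable (fun ω => M ω * b ω * z ω) μ :=
    hz.bdd_mul (hMb.mono hm).aestronglyMeasurable hMbC
  have hMbz : ∫ ω, M ω * b ω * z ω ∂μ = 0 := by
    have h1 := condExp_stronglyMeasurable_mul_of_bound hm hMb hz _ hMbC
    change ∫ ω, ((fun ω => M ω * b ω) * z) ω ∂μ = 0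
    rw [← integral_condExp hm, integral_congr_ae h1]
    have h2 : ((fun ω => M ω * b ω) * μ[z | m]) =ᵐ[μ] 0 := by
      filter_upwards [hz0] with ω hω
      simp [hω]
    rw [integral_congr_ae h2]; simp
  have hMqz0 : ∀ ω, 0 ≤ M ω * q ω * z ω ^ 2 := fun ω =>
    mul_nonneg (mul_nonneg (hM0 ω) (hq0 ω)) (sq_nonneg _)
  have hMqzm : AEStronglyMeasurable (fun ω => M ω * q ω * z ω ^ 2) μ :=
    (hMm.mul hqm).mul (hz.aestronglyMeasurable.pow 2)
  have hl : ∫⁻ ω, ENNReal.ofReal (M ω * q ω * z ω ^ 2) ∂μ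
      ≤ ∫⁻ ω, ENNReal.ofReal (M ω * q ω) ∂μ := by
    have := hz2 (fun ω => ENNReal.ofReal (M ω * q ω))
      (ENNReal.measurable_ofReal.comp (hM.mul hq).measurable)
    simpa only [ENNReal.ofReal_mul (mul_nonneg (hM0 _) (hq0 _))] using this
  have hfin : ∫⁻ ω, ENNReal.ofReal (M ω * q ω) ∂μ < ∞ := by
    rw [← ofReal_integral_eq_lintegral_ofReal iMq
      (ae_of_all _ fun ω => mul_nonneg (hM0 ω) (hq0 ω))]
    exact ENNReal.ofReal_lt_top
  -- Square integrability of `z` is not a hypothesis; it is needed only with the bounded weight `M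
  -- q`, where it follows from `hz2`.
  have iMqz : Integrable (fun ω => M ω * q ω * z ω ^ 2) μ := by
    refine ⟨hMqzm, ?_⟩
    rw [hasFiniteIntegral_iff_ofReal (ae_of_all _ hMqz0)]
    exact hl.trans_lt hfin
  have hMqz : ∫ ω, M ω * q ω * z ω ^ 2 ∂μ ≤ ∫ ω, M ω * q ω ∂μ := by
    rw [integral_eq_lintegral_of_nonneg_ae (ae_of_all _ hMqz0) hMqzm,
      integral_eq_lintegral_of_nonneg_ae
        (ae_of_all _ fun ω => mul_nonneg (hM0 ω) (hq0 ω)) (hMm.mul hqm)]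
    exact ENNReal.toReal_mono hfin.ne hl
  have iN : Integrable N μ := .of_bound (hN.mono hm).aestronglyMeasurable CN
    (ae_of_all _ fun ω => by rw [Real.norm_of_nonneg (hN0 ω)]; exact hNC ω)
  calc ∫ ω, N ω * Real.exp (U ω - q ω) ∂μ = ∫ ω, M ω * Real.exp (U ω) ∂μ := by
        congr 1; ext ω; rw [hMdef, sub_eq_neg_add, Real.exp_add]; ring
    _ ≤ ∫ ω, (M ω + M ω * b ω * z ω + M ω * q ω * z ω ^ 2) ∂μ := by
        refine integral_mono iMU ((iM.add iMbz).add iMqz) fun ω => ?_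
        have := mul_le_mul_of_nonneg_left (hexp ω) (hM0 ω)
        dsimp only
        linarith
    _ = ∫ ω, M ω ∂μ + ∫ ω, M ω * q ω * z ω ^ 2 ∂μ := by
        have iMM : Integrable (fun ω => M ω + M ω * b ω * z ω) μ := iM.add iMbz
        rw [integral_add iMM iMqz, integral_add iM iMbz, hMbz, add_zero]
    _ ≤ ∫ ω, M ω ∂μ + ∫ ω, M ω * q ω ∂μ := by gcongr
    _ = ∫ ω, (M ω + M ω * q ω) ∂μ := (integral_add iM iMq).symm
    _ ≤ ∫ ω, N ω ∂μ := by
        refine integral_mono (iM.add iMq) iN fun ω => ?_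
        have h1 := Real.add_one_le_exp (q ω)
        have h2 : M ω * Real.exp (q ω) = N ω := by
          rw [hMdef]; dsimp only; rw [mul_assoc, ← Real.exp_add]; simp
        have := mul_le_mul_of_nonneg_left h1 (hM0 ω)
        dsimp only
        linarith

/-- A Bernstein-type tail bound for a sum of adapted variables `U s` whose exponentials are majorized
by quadratic polynomials in the centered variables `z s`. -/
theorem measure_sum_ge_le [IsProbabilityMeasure μ] {ℱ : Filtration ℕ mΩ} {z U b q : ℕ → Ω → ℝ}
    {Cb Cq : ℕ → ℝ} (hz : ∀ s, Integrable (z s) μ) (hz0 : ∀ s, μ[z s | ℱ s] =ᵐ[μ] 0)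
    (hz2 : ∀ s, ∀ g : Ω → ℝ≥0∞, Measurable[ℱ s] g →
      ∫⁻ ω, g ω * ENNReal.ofReal (z s ω ^ 2) ∂μ ≤ ∫⁻ ω, g ω ∂μ)
    (hb : ∀ s, StronglyMeasurable[ℱ s] (b s)) (hbC : ∀ s ω, |b s ω| ≤ Cb s)
    (hq : ∀ s, StronglyMeasurable[ℱ s] (q s)) (hq0 : ∀ s ω, 0 ≤ q s ω)
    (hqC : ∀ s ω, q s ω ≤ Cq s)
    (hU : ∀ s, StronglyMeasurable[ℱ (s + 1)] (U s)) (hU1 : ∀ s ω, U s ω ≤ 1)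
    (hexp : ∀ s ω, Real.exp (U s ω) ≤ 1 + b s ω * z s ω + q s ω * z s ω ^ 2)
    (t : ℕ) (ℓ : ℝ) :
    μ {ω | ℓ ≤ ∑ s ∈ Finset.range t, (U s ω - q s ω)} ≤ ENNReal.ofReal (Real.exp (-ℓ)) := by
  set N : ℕ → Ω → ℝ := fun t ω => Real.exp (∑ s ∈ Finset.range t, (U s ω - q s ω)) with hN
  have hNm : ∀ t, StronglyMeasurable[ℱ t] (N t) := fun t =>
    Real.continuous_exp.comp_stronglyMeasurable <| Finset.stronglyMeasurable_fun_sum _ fun s hs =>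
      ((hU s).mono (ℱ.mono (Finset.mem_range.1 hs))).sub
        ((hq s).mono (ℱ.mono (Finset.mem_range.1 hs).le))
  have hN0 : ∀ t ω, 0 ≤ N t ω := fun t ω => (Real.exp_pos _).le
  -- Each summand is at most `1`, so the process is bounded at every fixed time and integrability is
  -- automatic.
  have hNC : ∀ t ω, N t ω ≤ Real.exp t := fun t ω => Real.exp_le_exp.2 <| by
    calc ∑ s ∈ Finset.range t, (U s ω - q s ω) ≤ ∑ s ∈ Finset.range t, (1 : ℝ) :=
          Finset.sum_le_sum fun s _ => by linarith [hU1 s ω, hq0 s ω]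
      _ = t := by simp
  have hE : ∀ t, ∫ ω, N t ω ∂μ ≤ 1 := by
    intro t
    induction t with
    | zero => simp [hN]
    | succ t ih =>
      have := integral_mul_exp_le (ℱ.le t) (hz t) (hz0 t) (hz2 t) (hb t) (hbC t) (hq t) (hq0 t)
        (hqC t) (hNm t) (hN0 t) (hNC t) ((hU t).mono (ℱ.le _)).aestronglyMeasurable (hU1 t)
        (hexp t)
      refine le_trans (le_of_eq ?_) (this.trans ih)
      congr 1; ext ω
      simp only [hN]
      rw [Finset.sum_range_succ, Real.exp_add]
  have iN : Integrable (N t) μ := .of_bound ((hNm t).mono (ℱ.le t)).aestronglyMeasurable _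
    (ae_of_all _ fun ω => by rw [Real.norm_of_nonneg (hN0 t ω)]; exact hNC t ω)
  have hmarkov := mul_meas_ge_le_integral_of_nonneg (ae_of_all _ (hN0 t)) iN (Real.exp ℓ)
  have hset : {ω | ℓ ≤ ∑ s ∈ Finset.range t, (U s ω - q s ω)} = {ω | Real.exp ℓ ≤ N t ω} := by
    ext ω; simp [hN]
  rw [hset, ← ofReal_measureReal]
  refine ENNReal.ofReal_le_ofReal ?_
  rw [Real.exp_neg, ← one_div, le_div_iff₀ (Real.exp_pos _), mul_comm]
  exact hmarkov.trans (hE t)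

end AdaOFUL

/-! ### Deterministic analysis along one trajectory. -/

namespace AdaOFUL

open Matrix

variable {d : ℕ}

theorem inner_eq_dotProduct (x y : EuclideanSpace ℝ (Fin d)) :
    inner ℝ x y = x.ofLp ⬝ᵥ y.ofLp := by
  rw [EuclideanSpace.inner_eq_star_dotProduct, dotProduct_comm]; simp

theorem norm_sq_eq_dotProduct (x : EuclideanSpace ℝ (Fin d)) : ‖x‖ ^ 2 = x.ofLp ⬝ᵥ x.ofLp := by
  rw [← inner_eq_dotProduct, real_inner_self_eq_norm_sq]

theorem wnorm_sq {A : Matrix (Fin d) (Fin d) ℝ} (hA : A.PosDef)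
    (x : EuclideanSpace ℝ (Fin d)) : wnorm A x ^ 2 = x.ofLp ⬝ᵥ A *ᵥ x.ofLp :=
  Real.sq_sqrt (dotProduct_mulVec_nonneg hA _)

theorem wnorm_nonneg (A : Matrix (Fin d) (Fin d) ℝ) (x : EuclideanSpace ℝ (Fin d)) :
    0 ≤ wnorm A x := Real.sqrt_nonneg _

theorem wnorm_smul (A : Matrix (Fin d) (Fin d) ℝ) {c : ℝ} (hc : 0 ≤ c)
    (x : EuclideanSpace ℝ (Fin d)) : wnorm A (c • x) = c * wnorm A x := by
  simp only [wnorm, WithLp.ofLp_smul, mulVec_smul, dotProduct_smul, smul_dotProduct, smul_eq_mul]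
  rw [← mul_assoc, Real.sqrt_mul (by positivity), Real.sqrt_mul_self hc]

namespace Params

variable (p : Params d)

theorem σmin_le_surrogate (H : Matrix (Fin d) (Fin d) ℝ) (x : EuclideanSpace ℝ (Fin d)) (v : ℝ) :
    p.σmin ≤ p.surrogate H x v := (le_max_right _ _).trans (le_max_left _ _)

theorem le_surrogate (H : Matrix (Fin d) (Fin d) ℝ) (x : EuclideanSpace ℝ (Fin d)) (v : ℝ) :
    v ≤ p.surrogate H x v := (le_max_left _ _).trans (le_max_left _ _)

theorem log_two_le_logTerm (hδ : 0 < p.δ) (hδ1 : p.δ < 1) {t : ℕ} (ht : 1 ≤ t) :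
    Real.log 2 ≤ p.logTerm t := by
  have h1 : (1 : ℝ) ≤ t := by exact_mod_cast ht
  refine Real.log_le_log two_pos ?_
  rw [le_div_iff₀ hδ]
  nlinarith

theorem logTerm_mono (hδ : 0 < p.δ) {s t : ℕ} (hs : 1 ≤ s) (hst : s ≤ t) :
    p.logTerm s ≤ p.logTerm t := by
  have h1 : (0 : ℝ) < s := by exact_mod_cast hs
  unfold logTerm
  gcongr

theorem exp_neg_logTerm (hδ : 0 < p.δ) {t : ℕ} (ht : 1 ≤ t) :
    Real.exp (-p.logTerm t) = p.δ / 2 * ((t : ℝ) ^ 2)⁻¹ := by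
  have h1 : (0 : ℝ) < t := by exact_mod_cast ht
  rw [Real.exp_neg, logTerm, Real.exp_log (by positivity)]
  field_simp

section Trajectory

variable (φ : ℕ → EuclideanSpace ℝ (Fin d)) (ν ε : ℕ → ℝ)

/-- The rescaled arm `φ_{s+1} / σ_{s+1}`. -/
noncomputable def feature (s : ℕ) : Fin d → ℝ := ((p.σ φ ν (s + 1))⁻¹ • φ (s + 1)).ofLp

/-- `w² / (1 + w²)`, the squared norm of the rescaled arm in the updated inverse shape matrix. -/
noncomputable def leverage (s : ℕ) : ℝ := p.w φ ν (s + 1) ^ 2 / (1 + p.w φ ν (s + 1) ^ 2)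

/-- The rescaled noise `ε_{s+1} / σ_{s+1}`. -/
noncomputable def scaledNoise (s : ℕ) : ℝ := ε (s + 1) / p.σ φ ν (s + 1)

/-- The derivative of the pseudo-Huber loss at the rescaled noise. -/
noncomputable def score (s : ℕ) : ℝ := huberScore (p.τ φ ν (s + 1)) (p.scaledNoise φ ν ε s)

/-- Up to sign, the gradient at the true parameter of the loss without its ridge term. -/
noncomputable def scoreSum (t : ℕ) : Fin d → ℝ :=
  ∑ s ∈ Finset.range t, p.score φ ν ε s • p.feature φ ν s

/-- The squared norm of `scoreSum` in the inverse shape matrix. -/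
noncomputable def selfNorm (t : ℕ) : ℝ :=
  p.scoreSum φ ν ε t ⬝ᵥ (p.shape φ ν t)⁻¹ *ᵥ p.scoreSum φ ν ε t

/-- The inner product of the next rescaled arm with `scoreSum` in the inverse shape matrix, set to
zero once `selfNorm` exceeds `b²`. -/
noncomputable def truncCross (b : ℝ) (s : ℕ) : ℝ :=
  if p.selfNorm φ ν ε s ≤ b ^ 2 then
    p.feature φ ν s ⬝ᵥ (p.shape φ ν s)⁻¹ *ᵥ p.scoreSum φ ν ε s else 0

/-- `η` times the increment of the truncated majorant of `selfNorm`. -/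
noncomputable def increment (η b : ℝ) (s : ℕ) : ℝ :=
  η * (2 * p.score φ ν ε s * p.truncCross φ ν ε b s / (1 + p.w φ ν (s + 1) ^ 2)
    + p.score φ ν ε s ^ 2 * p.w φ ν (s + 1) ^ 2 / (1 + p.w φ ν (s + 1) ^ 2))

/-- The event that the rescaled noise leaves the region where the loss is strongly convex. -/
def IsOutlier (s : ℕ) : Prop := p.τ φ ν (s + 1) / 2 < |p.scaledNoise φ ν ε s|

noncomputable instance (s : ℕ) : Decidable (p.IsOutlier φ ν ε s) := Classical.dec _

theorem shape_succ (s : ℕ) : p.shape φ ν (s + 1)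
    = p.shape φ ν s + vecMulVec (p.feature φ ν s) (p.feature φ ν s) := rfl

theorem shape_zero : p.shape φ ν 0 = p.lam • 1 := rfl

variable {p}

theorem feature_dotProduct_self_le (hσmin : 0 < p.σmin) (hφ : ∀ t, 1 ≤ t → ‖φ t‖ ≤ p.L) (s : ℕ) :
    p.feature φ ν s ⬝ᵥ p.feature φ ν s ≤ p.L ^ 2 / p.σmin ^ 2 := by
  have hσ : p.σmin ≤ p.σ φ ν (s + 1) := p.σmin_le_surrogate _ _ _
  have hσ0 := hσmin.trans_le hσ
  rw [feature, ← norm_sq_eq_dotProduct, norm_smul, Real.norm_of_nonneg (inv_nonneg.2 hσ0.le),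
    mul_pow, inv_pow, ← div_eq_inv_mul]
  have := hφ (s + 1) (by omega)
  gcongr

theorem leverage_nonneg (s : ℕ) : 0 ≤ p.leverage φ ν s := by unfold leverage; positivity

theorem w_eq (hσmin : 0 < p.σmin) (s : ℕ) :
    p.w φ ν (s + 1) = wnorm (p.shape φ ν s)⁻¹ (φ (s + 1)) / p.σ φ ν (s + 1) := by
  have hσ : p.σmin ≤ p.σ φ ν (s + 1) := p.σmin_le_surrogate _ _ _
  rw [w, wnorm_smul _ (inv_nonneg.2 (hσmin.le.trans hσ)), div_eq_inv_mul]
  rfl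

/-- The entry of `σ` involving `c₀` forces `w ≤ c₀`, and `c₀² = 1 / (108 log (2T²/δ))`. -/
theorem leverage_le (hσmin : 0 < p.σmin) (hℓ : 0 < p.logTerm p.T) (s : ℕ) :
    p.leverage φ ν s ≤ 1 / (108 * p.logTerm p.T) := by
  have hσ : p.σmin ≤ p.σ φ ν (s + 1) := p.σmin_le_surrogate _ _ _
  have hc : 0 < p.c₀ := by unfold c₀; positivity
  have h1 : wnorm (p.shape φ ν s)⁻¹ (φ (s + 1)) / p.c₀ ≤ p.σ φ ν (s + 1) :=
    (le_max_left _ _).trans (le_max_right _ _)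
  have h2 : p.w φ ν (s + 1) ≤ p.c₀ := by
    rw [w_eq φ ν hσmin, div_le_iff₀ (hσmin.trans_le hσ), mul_comm]
    rwa [div_le_iff₀ hc] at h1
  have hc2 : p.c₀ ^ 2 = 1 / (108 * p.logTerm p.T) := by
    rw [c₀, div_pow, mul_pow, Real.sq_sqrt (by positivity)]; ring
  have hw : 0 ≤ p.w φ ν (s + 1) := wnorm_nonneg _ _
  rw [← hc2]
  calc p.leverage φ ν s ≤ p.w φ ν (s + 1) ^ 2 := div_le_self (sq_nonneg _) (by nlinarith)
    _ ≤ _ := by gcongr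

/-- The purpose of the entry of `σ` involving `c₁`: moving from the true parameter to any point of
the ball shifts a rescaled residual by at most `τ / 6`, as `pseudoHuber_ge_quadratic` requires. With
`k⁴ = c₁ d`, that entry gives `L B w ≤ σ k²`. -/
theorem abs_feature_dotProduct_le (hd : 1 ≤ d) (hσmin : 0 < p.σmin) (hℓ : 0 < p.logTerm p.T)
    (hτ0 : 0 < p.τ₀) (hτ : 2 * Real.sqrt d ≤ p.τ₀ * Real.sqrt (p.logTerm p.T))
    (hL : 0 ≤ p.L) (hB : 0 ≤ p.B)
    (hφ : ∀ t, 1 ≤ t → ‖φ t‖ ≤ p.L) (s : ℕ) (hw : 0 < p.w φ ν (s + 1))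
    {v : EuclideanSpace ℝ (Fin d)} (hv : ‖v‖ ≤ 2 * p.B) :
    |p.feature φ ν s ⬝ᵥ v.ofLp| ≤ p.τ φ ν (s + 1) / 6 := by
  have hσ : p.σmin ≤ p.σ φ ν (s + 1) := p.σmin_le_surrogate _ _ _
  have hσ0 := hσmin.trans_le hσ
  have hd0 : (0 : ℝ) < d := by exact_mod_cast hd
  have hc : 0 < p.c₁ := by unfold c₁; positivity
  set k : ℝ := p.c₁ ^ (1 / 4 : ℝ) * (d : ℝ) ^ (1 / 4 : ℝ) with hk
  have hk0 : 0 < k := by positivity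
  have hk4 : k ^ 4 = p.c₁ * d := by
    rw [hk, mul_pow, ← Real.rpow_natCast, ← Real.rpow_natCast ((d : ℝ) ^ (1 / 4 : ℝ)),
      ← Real.rpow_mul hc.le, ← Real.rpow_mul hd0.le]
    norm_num
  -- Squared, this asks for `(144 / 42) d ≤ τ₀² ℓ`, while the hypothesis on `τ₀` provides `4 d ≤ τ₀²
  -- ℓ`.
  have hkτ : 2 * k ^ 2 ≤ p.τ₀ / 6 := by
    refine abs_le_of_sq_le_sq' ?_ (by positivity) |>.2
    have h1 : (2 * Real.sqrt d) ^ 2 ≤ (p.τ₀ * Real.sqrt (p.logTerm p.T)) ^ 2 := by gcongr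
    rw [mul_pow, mul_pow, Real.sq_sqrt hd0.le, Real.sq_sqrt hℓ.le] at h1
    have h2 : (2 * k ^ 2) ^ 2 = 2 ^ 2 * d / (42 * p.logTerm p.T) := by
      rw [show (2 * k ^ 2) ^ 2 = 4 * k ^ 4 by ring, hk4, c₁]; ring
    rw [h2, div_le_iff₀ (by positivity)]
    nlinarith [mul_pos (pow_pos hτ0 2) hℓ]
  set n := wnorm (p.shape φ ν s)⁻¹ (φ (s + 1)) with hn
  have hn0 : 0 ≤ n := wnorm_nonneg _ _
  have h1 : Real.sqrt (p.L * p.B) * Real.sqrt n / k ≤ p.σ φ ν (s + 1) :=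
    (le_max_right _ _).trans (le_max_right _ _)
  have hwn : n = p.w φ ν (s + 1) * p.σ φ ν (s + 1) := by
    rw [w_eq φ ν hσmin, div_mul_cancel₀ _ hσ0.ne']
  have h2 : p.L * p.B * p.w φ ν (s + 1) ≤ p.σ φ ν (s + 1) * k ^ 2 := by
    rw [div_le_iff₀ hk0] at h1
    have h3 := pow_le_pow_left₀ (by positivity) h1 2
    rw [mul_pow, mul_pow, Real.sq_sqrt (by positivity), Real.sq_sqrt hn0, hwn] at h3
    nlinarith
  have hτle : p.τ₀ / p.w φ ν (s + 1) ≤ p.τ φ ν (s + 1) := by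
    unfold τ
    gcongr
    exact le_mul_of_one_le_right hτ0.le (Real.one_le_sqrt.2 (by nlinarith))
  have h4 : |p.feature φ ν s ⬝ᵥ v.ofLp| ≤ (p.L / p.σ φ ν (s + 1)) * (2 * p.B) := by
    rw [feature, ← inner_eq_dotProduct]
    refine (abs_real_inner_le_norm _ _).trans ?_
    rw [norm_smul, Real.norm_of_nonneg (inv_nonneg.2 hσ0.le), ← div_eq_inv_mul]
    have := hφ (s + 1) (by omega)
    gcongr
  calc |p.feature φ ν s ⬝ᵥ v.ofLp| ≤ (p.L / p.σ φ ν (s + 1)) * (2 * p.B) := h4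
    _ = 2 * (p.L * p.B * p.w φ ν (s + 1)) / (p.σ φ ν (s + 1) * p.w φ ν (s + 1)) := by
        field_simp
    _ ≤ 2 * (p.σ φ ν (s + 1) * k ^ 2) / (p.σ φ ν (s + 1) * p.w φ ν (s + 1)) := by gcongr
    _ = 2 * k ^ 2 / p.w φ ν (s + 1) := by field_simp
    _ ≤ p.τ₀ / 6 / p.w φ ν (s + 1) := by gcongr
    _ = p.τ₀ / p.w φ ν (s + 1) / 6 := by ring
    _ ≤ _ := by gcongr

variable (hlam : 0 < p.lam)
include hlam

theorem shape_posDef (s : ℕ) : (p.shape φ ν s).PosDef :=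
  posDef_of_rankOne_updates hlam (p.shape_zero φ ν) (p.shape_succ φ ν) s

theorem w_sq (s : ℕ) : p.w φ ν (s + 1) ^ 2
    = p.feature φ ν s ⬝ᵥ (p.shape φ ν s)⁻¹ *ᵥ p.feature φ ν s :=
  wnorm_sq (shape_posDef φ ν hlam s).inv _

/-- The rank-one formula for the inverse, with its negative square term dropped. -/
theorem selfNorm_succ_le (s : ℕ) : p.selfNorm φ ν ε (s + 1) ≤ p.selfNorm φ ν ε s
    + (2 * p.score φ ν ε s
        * (p.feature φ ν s ⬝ᵥ (p.shape φ ν s)⁻¹ *ᵥ p.scoreSum φ ν ε s)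
        / (1 + p.w φ ν (s + 1) ^ 2)
      + p.score φ ν ε s ^ 2 * p.w φ ν (s + 1) ^ 2 / (1 + p.w φ ν (s + 1) ^ 2)) := by
  have h := dotProduct_inv_rankOne (shape_posDef φ ν hlam s) (p.feature φ ν s)
    (p.scoreSum φ ν ε s) (p.score φ ν ε s)
  rw [← shape_succ, ← w_sq φ ν hlam] at h
  have hS : p.scoreSum φ ν ε (s + 1)
      = p.scoreSum φ ν ε s + p.score φ ν ε s • p.feature φ ν s := Finset.sum_range_succ _ _
  have : 0 ≤ (p.feature φ ν s ⬝ᵥ (p.shape φ ν s)⁻¹ *ᵥ p.scoreSum φ ν ε s) ^ 2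
    / (1 + p.w φ ν (s + 1) ^ 2) := by positivity
  rw [selfNorm, selfNorm, hS, h]
  linarith

theorem abs_truncCross_le {b : ℝ} (hb : 0 ≤ b) (s : ℕ) :
    |p.truncCross φ ν ε b s| ≤ p.w φ ν (s + 1) * b := by
  have hw : 0 ≤ p.w φ ν (s + 1) := wnorm_nonneg _ _
  unfold truncCross
  split_ifs with h
  · refine abs_le_of_sq_le_sq ?_ (by positivity)
    refine (dotProduct_mulVec_sq_le (shape_posDef φ ν hlam s).inv _ _).trans ?_
    rw [← w_sq φ ν hlam, mul_pow]
    gcongr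
    exact h
  · simpa using mul_nonneg hw hb

theorem selfNorm_le_sum (η b : ℝ) (hη : 0 ≤ η) (t : ℕ)
    (h : ∀ s < t, p.selfNorm φ ν ε s ≤ b ^ 2) :
    η * p.selfNorm φ ν ε t ≤ ∑ s ∈ Finset.range t, p.increment φ ν ε η b s := by
  induction t with
  | zero => simp [selfNorm, scoreSum]
  | succ t ih =>
    rw [Finset.sum_range_succ, increment, truncCross, if_pos (h t (by omega))]
    have h1 := mul_le_mul_of_nonneg_left (selfNorm_succ_le φ ν ε hlam t) hη
    have h2 := ih fun s hs => h s (by omega)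
    linarith

theorem sum_leverage_le (hd : 1 ≤ d) (hσmin : 0 < p.σmin) (hφ : ∀ t, 1 ≤ t → ‖φ t‖ ≤ p.L)
    {t : ℕ} (ht : t ≤ p.T) : ∑ s ∈ Finset.range t, p.leverage φ ν s ≤ p.κ := by
  have h := sum_div_one_add_le hd hlam (p.shape_zero φ ν) (p.shape_succ φ ν) p.T
    fun s _ => feature_dotProduct_self_le φ ν hσmin hφ s
  simp_rw [← w_sq φ ν hlam] at h
  calc ∑ s ∈ Finset.range t, p.leverage φ ν s ≤ ∑ s ∈ Finset.range p.T, p.leverage φ ν s :=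
        Finset.sum_le_sum_of_subset_of_nonneg (Finset.range_mono ht)
          fun s _ _ => leverage_nonneg φ ν s
    _ ≤ _ := h
    _ = p.κ := by
        rw [κ]
        have hd' : (0 : ℝ) < d := by exact_mod_cast hd
        congr 3
        field_simp

theorem feature_dotProduct_eq_zero {s : ℕ} (hw : p.w φ ν (s + 1) = 0) (v : Fin d → ℝ) :
    p.feature φ ν s ⬝ᵥ v = 0 := by
  have := dotProduct_sq_le (shape_posDef φ ν hlam s) (p.feature φ ν s) v
  rw [← w_sq φ ν hlam, hw] at this
  nlinarith [sq_nonneg (p.feature φ ν s ⬝ᵥ v)]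

/-- Quadratic growth on ordinary rounds and plain convexity on outliers, in one formula that can be
summed over all rounds. If `w = 0`, the rescaled arm is orthogonal to everything and both sides
agree. -/
theorem pseudoHuber_residual_ge (hd : 1 ≤ d) (hσmin : 0 < p.σmin) (hℓ : 0 < p.logTerm p.T)
    (hτ0 : 0 < p.τ₀) (hτ : 2 * Real.sqrt d ≤ p.τ₀ * Real.sqrt (p.logTerm p.T))
    (hL : 0 ≤ p.L) (hB : 0 ≤ p.B)
    (hφ : ∀ t, 1 ≤ t → ‖φ t‖ ≤ p.L) (s : ℕ) {v : EuclideanSpace ℝ (Fin d)}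
    (hv : ‖v‖ ≤ 2 * p.B) :
    pseudoHuber (p.τ φ ν (s + 1)) (p.scaledNoise φ ν ε s)
        - p.score φ ν ε s * (p.feature φ ν s ⬝ᵥ v.ofLp)
        + 3 / 10 * (p.feature φ ν s ⬝ᵥ v.ofLp) ^ 2
        - 3 / 10 * (if p.IsOutlier φ ν ε s then (p.feature φ ν s ⬝ᵥ v.ofLp) ^ 2 else 0)
      ≤ pseudoHuber (p.τ φ ν (s + 1))
          (p.scaledNoise φ ν ε s - p.feature φ ν s ⬝ᵥ v.ofLp) := by
  have hw0 : 0 ≤ p.w φ ν (s + 1) := wnorm_nonneg _ _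
  rcases hw0.eq_or_lt with hw | hw
  · simp [feature_dotProduct_eq_zero φ ν hlam hw.symm]
  have hτpos : 0 < p.τ φ ν (s + 1) := by unfold τ; positivity
  set a := p.feature φ ν s ⬝ᵥ v.ofLp with ha
  set y := p.scaledNoise φ ν ε s
  have e : y - a - y = -a := by ring
  split_ifs with h
  · have := pseudoHuber_ge hτpos.le (y - a) y
    rw [e] at this
    change _ - huberScore (p.τ φ ν (s + 1)) y * a + _ - _ ≤ _
    linarith
  · have := pseudoHuber_ge_quadratic hτpos (x := y - a) (not_lt.1 h) (by
      rw [e, abs_neg]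
      exact abs_feature_dotProduct_le φ ν hd hσmin hℓ hτ0 hτ hL hB hφ s hw hv)
    rw [e] at this
    change _ - huberScore (p.τ φ ν (s + 1)) y * a + _ - _ ≤ _
    nlinarith

/-- A minimizer of the loss is close to the true parameter if the gradient there is small and the
outliers have small total leverage. -/
theorem wnorm_sub_le (hd : 1 ≤ d) (hσmin : 0 < p.σmin) (hℓ : 0 < p.logTerm p.T)
    (hτ0 : 0 < p.τ₀) (hτ : 2 * Real.sqrt d ≤ p.τ₀ * Real.sqrt (p.logTerm p.T))
    (hφ : ∀ t, 1 ≤ t → ‖φ t‖ ≤ p.L) {θstar θ : EuclideanSpace ℝ (Fin d)} {y : ℕ → ℝ}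
    (hy : ∀ t, 1 ≤ t → y t = inner ℝ (φ t) θstar + ε t)
    (hθstar : ‖θstar‖ ≤ p.B) (hθ : ‖θ‖ ≤ p.B) {t : ℕ}
    (hmin : p.loss φ ν y t θ ≤ p.loss φ ν y t θstar) {b : ℝ} (hb : 0 ≤ b)
    (hself : p.selfNorm φ ν ε t ≤ b ^ 2)
    (hout : ∑ s ∈ Finset.range t, (if p.IsOutlier φ ν ε s then p.leverage φ ν s else 0) ≤ 1 / 6) :
    wnorm (p.shape φ ν t) (θ - θstar) ≤ 4 * (b + Real.sqrt p.lam * p.B) := by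
  have hB : 0 ≤ p.B := (norm_nonneg _).trans hθ
  have hL : 0 ≤ p.L := (norm_nonneg _).trans (hφ 1 le_rfl)
  set v := θ - θstar with hv
  have hvB : ‖v‖ ≤ 2 * p.B := (norm_sub_le _ _).trans (by linarith)
  set W := wnorm (p.shape φ ν t) v with hW
  have hW0 : 0 ≤ W := wnorm_nonneg _ _
  have hpd := shape_posDef φ ν hlam t
  have hW2 : W ^ 2 = v.ofLp ⬝ᵥ p.shape φ ν t *ᵥ v.ofLp := wnorm_sq hpd v
  have hWsum : W ^ 2 = p.lam * ‖v‖ ^ 2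
      + ∑ s ∈ Finset.range t, (p.feature φ ν s ⬝ᵥ v.ofLp) ^ 2 := by
    rw [hW2, dotProduct_mulVec_eq_sum (p.shape_zero φ ν) (p.shape_succ φ ν),
      norm_sq_eq_dotProduct]
  have hres : ∀ (x : EuclideanSpace ℝ (Fin d)) (s : ℕ),
      (y (s + 1) - inner ℝ (φ (s + 1)) x) / p.σ φ ν (s + 1)
        = p.scaledNoise φ ν ε s - p.feature φ ν s ⬝ᵥ (x - θstar).ofLp := by
    intro x s
    rw [hy (s + 1) (by omega), feature, ← inner_eq_dotProduct, inner_smul_left, inner_sub_right,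
      scaledNoise]
    simp only [conj_trivial]
    ring
  have hloss : ∀ x, p.loss φ ν y t x = p.lam / 2 * ‖x‖ ^ 2 + ∑ s ∈ Finset.range t,
      pseudoHuber (p.τ φ ν (s + 1))
        (p.scaledNoise φ ν ε s - p.feature φ ν s ⬝ᵥ (x - θstar).ofLp) := by
    intro x
    rw [loss, ← Finset.Ico_add_one_right_eq_Icc, Finset.sum_Ico_eq_sum_range]
    congr 1
    refine Finset.sum_congr rfl fun s _ => ?_
    rw [add_comm 1 s, hres]
  rw [hloss, hloss, ← hv] at hmin
  simp only [sub_self, WithLp.ofLp_zero, dotProduct_zero, sub_zero] at hmin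
  have hsum := Finset.sum_le_sum fun s (_ : s ∈ Finset.range t) =>
    pseudoHuber_residual_ge φ ν ε hlam hd hσmin hℓ hτ0 hτ hL hB hφ s hvB
  rw [Finset.sum_sub_distrib, Finset.sum_add_distrib, Finset.sum_sub_distrib, ← Finset.mul_sum,
    ← Finset.mul_sum] at hsum
  have hS : ∑ s ∈ Finset.range t, p.score φ ν ε s * (p.feature φ ν s ⬝ᵥ v.ofLp)
      = p.scoreSum φ ν ε t ⬝ᵥ v.ofLp := by
    rw [scoreSum, sum_dotProduct]
    simp only [smul_dotProduct, smul_eq_mul]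
  rw [hS] at hsum
  -- An outlier can remove at most its leverage times `W²` from the curvature.
  have hbad : ∑ s ∈ Finset.range t,
      (if p.IsOutlier φ ν ε s then (p.feature φ ν s ⬝ᵥ v.ofLp) ^ 2 else 0) ≤ 1 / 6 * W ^ 2 := by
    refine le_trans ?_ (mul_le_mul_of_nonneg_right hout (sq_nonneg W))
    rw [Finset.sum_mul]
    refine Finset.sum_le_sum fun s hs => ?_
    split_ifs
    · have := dotProduct_sq_le_of_lt hlam (p.shape_zero φ ν) (p.shape_succ φ ν)
        (Finset.mem_range.1 hs) v.ofLp
      rwa [← w_sq φ ν hlam, ← hW2] at this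
    · simp
  have hSv : p.scoreSum φ ν ε t ⬝ᵥ v.ofLp ≤ b * W := by
    refine abs_le_of_sq_le_sq' ?_ (by positivity) |>.2
    refine (dotProduct_sq_le hpd _ _).trans ?_
    rw [mul_pow, ← hW2]
    gcongr
    exact hself
  have hnorm : ‖θ‖ ^ 2 = ‖θstar‖ ^ 2 + 2 * inner ℝ θstar v + ‖v‖ ^ 2 := by
    rw [← norm_add_sq_real, hv, add_sub_cancel]
  have hridge : -(p.lam * inner ℝ θstar v) ≤ Real.sqrt p.lam * p.B * W := by
    have h1 : Real.sqrt p.lam * ‖v‖ ≤ W := by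
      refine abs_le_of_sq_le_sq' ?_ hW0 |>.2
      rw [mul_pow, Real.sq_sqrt hlam.le, hWsum]
      exact le_add_of_nonneg_right (Finset.sum_nonneg fun _ _ => sq_nonneg _)
    have h2 : -inner ℝ θstar v ≤ p.B * ‖v‖ :=
      (neg_le_abs _).trans ((abs_real_inner_le_norm _ _).trans (by gcongr))
    have h3 := Real.mul_self_sqrt hlam.le
    calc -(p.lam * inner ℝ θstar v) = p.lam * -inner ℝ θstar v := by ring
      _ ≤ p.lam * (p.B * ‖v‖) := by gcongr
      _ = Real.sqrt p.lam * p.B * (Real.sqrt p.lam * ‖v‖) := by linear_combination (-p.B * ‖v‖) * h3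
      _ ≤ _ := by gcongr
  have hvn : 0 ≤ p.lam * ‖v‖ ^ 2 := by positivity
  -- The surviving curvature is `3/10 * (1 - 1/6) = 1/4`. The ridge term contributes `λ/2 ‖v‖²`,
  -- more than the `3/10 λ ‖v‖²` by which `3/10 W²` exceeds the sum over rounds.
  have hfinal : W ^ 2 ≤ 4 * (b + Real.sqrt p.lam * p.B) * W := by
    rw [hnorm] at hmin
    linarith
  rcases hW0.eq_or_lt with h | h
  · rw [← h]; positivity
  · rw [pow_two] at hfinal
    exact le_of_mul_le_mul_right hfinal h

end Trajectory

end Params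

end AdaOFUL

/-! ### Measurability along the filtration. -/

namespace AdaOFUL

open Matrix

variable {d : ℕ}

section Measurability

variable {Ω : Type*} {m : MeasurableSpace Ω}

theorem stronglyMeasurable_matrix_inv {A : Ω → Matrix (Fin d) (Fin d) ℝ}
    (hA : StronglyMeasurable A) : StronglyMeasurable fun ω => (A ω)⁻¹ := by
  simp_rw [Matrix.inv_def, Ring.inverse_eq_inv']
  have h1 : StronglyMeasurable fun ω => ((A ω).det)⁻¹ :=
    ((Continuous.matrix_det continuous_id).comp_stronglyMeasurable hA).inv₀
  have h2 : StronglyMeasurable fun ω => (A ω).adjugate :=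
    (Continuous.matrix_adjugate continuous_id).comp_stronglyMeasurable hA
  exact h1.smul h2

theorem stronglyMeasurable_bilin {A : Ω → Matrix (Fin d) (Fin d) ℝ} {x y : Ω → Fin d → ℝ}
    (hA : StronglyMeasurable A) (hx : StronglyMeasurable x) (hy : StronglyMeasurable y) :
    StronglyMeasurable fun ω => x ω ⬝ᵥ (A ω)⁻¹ *ᵥ y ω := by
  have h : Continuous fun q : Matrix (Fin d) (Fin d) ℝ × (Fin d → ℝ) × (Fin d → ℝ) =>
      q.2.1 ⬝ᵥ q.1 *ᵥ q.2.2 :=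
    continuous_snd.fst.dotProduct (continuous_fst.matrix_mulVec continuous_snd.snd)
  exact h.comp_stronglyMeasurable ((stronglyMeasurable_matrix_inv hA).prodMk (hx.prodMk hy))

theorem stronglyMeasurable_ofLp {x : Ω → EuclideanSpace ℝ (Fin d)} (hx : StronglyMeasurable x) :
    StronglyMeasurable fun ω => (x ω).ofLp :=
  (PiLp.continuous_ofLp 2 _).comp_stronglyMeasurable hx

theorem stronglyMeasurable_wnorm_inv {A : Ω → Matrix (Fin d) (Fin d) ℝ}
    {x : Ω → EuclideanSpace ℝ (Fin d)} (hA : StronglyMeasurable A) (hx : StronglyMeasurable x) :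
    StronglyMeasurable fun ω => wnorm (A ω)⁻¹ (x ω) :=
  Real.continuous_sqrt.comp_stronglyMeasurable
    (stronglyMeasurable_bilin hA (stronglyMeasurable_ofLp hx) (stronglyMeasurable_ofLp hx))

theorem measurable_huberScore {τ x : Ω → ℝ} (hτ : Measurable τ) (hx : Measurable x) :
    Measurable fun ω => huberScore (τ ω) (x ω) :=
  (hτ.mul hx).div ((hτ.pow_const 2).add (hx.pow_const 2)).sqrt

namespace Params

variable (p : Params d)

theorem stronglyMeasurable_surrogate {A : Ω → Matrix (Fin d) (Fin d) ℝ}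
    {x : Ω → EuclideanSpace ℝ (Fin d)} {v : Ω → ℝ} (hA : StronglyMeasurable A)
    (hx : StronglyMeasurable x) (hv : StronglyMeasurable v) :
    StronglyMeasurable fun ω => p.surrogate (A ω) (x ω) (v ω) := by
  have h := (stronglyMeasurable_wnorm_inv hA hx).measurable
  exact ((hv.measurable.max measurable_const).max
    ((h.div_const _).max ((h.sqrt.const_mul _).div_const _))).stronglyMeasurable

end Params

end Measurability

namespace Params

variable {p : Params d} {Ω : Type*} {mΩ : MeasurableSpace Ω} {ℱ : Filtration ℕ mΩ}
  {φ : ℕ → Ω → EuclideanSpace ℝ (Fin d)} {ν ε : ℕ → Ω → ℝ}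

section Adapted

variable (hφ : ∀ s, StronglyMeasurable[ℱ s] (φ (s + 1)))
  (hν : ∀ s, StronglyMeasurable[ℱ s] (ν (s + 1)))
include hφ hν

theorem stronglyMeasurable_shape (s : ℕ) :
    StronglyMeasurable[ℱ s] fun ω => p.shape (φ · ω) (ν · ω) s := by
  induction s with
  | zero => exact stronglyMeasurable_const
  | succ s ih =>
    have hσ := p.stronglyMeasurable_surrogate ih (hφ s) (hν s)
    have hx := stronglyMeasurable_ofLp (hσ.inv₀.smul (hφ s))
    have h : Continuous fun q : (Fin d → ℝ) => vecMulVec q q :=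
      continuous_id.matrix_vecMulVec continuous_id
    exact (ih.add (h.comp_stronglyMeasurable hx)).mono (ℱ.mono s.le_succ)

theorem stronglyMeasurable_σ (s : ℕ) :
    StronglyMeasurable[ℱ s] fun ω => p.σ (φ · ω) (ν · ω) (s + 1) :=
  p.stronglyMeasurable_surrogate (stronglyMeasurable_shape hφ hν s) (hφ s) (hν s)

theorem stronglyMeasurable_feature (s : ℕ) :
    StronglyMeasurable[ℱ s] fun ω => p.feature (φ · ω) (ν · ω) s :=
  stronglyMeasurable_ofLp ((stronglyMeasurable_σ hφ hν s).inv₀.smul (hφ s))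

theorem measurable_w (s : ℕ) : Measurable[ℱ s] fun ω => p.w (φ · ω) (ν · ω) (s + 1) :=
  (stronglyMeasurable_wnorm_inv (stronglyMeasurable_shape hφ hν s)
    ((stronglyMeasurable_σ hφ hν s).inv₀.smul (hφ s))).measurable

theorem measurable_leverage (s : ℕ) : Measurable[ℱ s] fun ω => p.leverage (φ · ω) (ν · ω) s :=
  have h := (measurable_w (p := p) hφ hν s).pow_const 2
  h.div (h.const_add 1)

theorem measurable_τ (s : ℕ) : Measurable[ℱ s] fun ω => p.τ (φ · ω) (ν · ω) (s + 1) :=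
  have h := measurable_w (p := p) hφ hν s
  (((h.pow_const 2).const_add 1).sqrt.const_mul p.τ₀).div h

variable (hε : ∀ s, StronglyMeasurable[ℱ (s + 1)] (ε (s + 1)))
include hε

theorem measurable_scaledNoise (s : ℕ) :
    Measurable[ℱ (s + 1)] fun ω => p.scaledNoise (φ · ω) (ν · ω) (ε · ω) s :=
  (hε s).measurable.div
    ((stronglyMeasurable_σ hφ hν s).measurable.mono (ℱ.mono s.le_succ) le_rfl)

theorem measurable_score (s : ℕ) :
    Measurable[ℱ (s + 1)] fun ω => p.score (φ · ω) (ν · ω) (ε · ω) s :=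
  measurable_huberScore ((measurable_τ hφ hν s).mono (ℱ.mono s.le_succ) le_rfl)
    (measurable_scaledNoise hφ hν hε s)

theorem stronglyMeasurable_scoreSum (t : ℕ) :
    StronglyMeasurable[ℱ t] fun ω => p.scoreSum (φ · ω) (ν · ω) (ε · ω) t := by
  unfold scoreSum
  refine Finset.stronglyMeasurable_fun_sum _ fun s hs => ?_
  have hst := Finset.mem_range.1 hs
  exact ((measurable_score hφ hν hε s).stronglyMeasurable.mono (ℱ.mono hst)).smul
    ((stronglyMeasurable_feature hφ hν s).mono (ℱ.mono hst.le))

theorem measurable_truncCross (b : ℝ) (s : ℕ) :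
    Measurable[ℱ s] fun ω => p.truncCross (φ · ω) (ν · ω) (ε · ω) b s := by
  have hS := stronglyMeasurable_scoreSum (p := p) hφ hν hε s
  have hH := stronglyMeasurable_shape (p := p) hφ hν s
  exact Measurable.ite (measurableSet_le (stronglyMeasurable_bilin hH hS hS).measurable
    measurable_const) (stronglyMeasurable_bilin hH (stronglyMeasurable_feature hφ hν s) hS).measurable
    measurable_const

theorem measurable_increment (η b : ℝ) (s : ℕ) :
    Measurable[ℱ (s + 1)] fun ω => p.increment (φ · ω) (ν · ω) (ε · ω) η b s := by
  have hψ := measurable_score (p := p) hφ hν hε s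
  have ha := (measurable_truncCross (p := p) hφ hν hε b s).mono (ℱ.mono s.le_succ) le_rfl
  have hw := ((measurable_w (p := p) hφ hν s).mono (ℱ.mono s.le_succ) le_rfl).pow_const 2
  exact ((((hψ.const_mul 2).mul ha).div (hw.const_add 1)).add
    (((hψ.pow_const 2).mul hw).div (hw.const_add 1))).const_mul η

theorem measurableSet_isOutlier (s : ℕ) :
    MeasurableSet[ℱ (s + 1)] {ω | p.IsOutlier (φ · ω) (ν · ω) (ε · ω) s} :=
  measurableSet_lt (((measurable_τ hφ hν s).mono (ℱ.mono s.le_succ) le_rfl).div_const 2)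
    (measurable_abs.comp (measurable_scaledNoise hφ hν hε s))

end Adapted

end Params

/-- The conditional moment assumptions on the rescaled noise. -/
structure IsUnitNoise {Ω : Type*} {mΩ : MeasurableSpace Ω} (μ : Measure Ω) (ℱ : Filtration ℕ mΩ)
    (z : ℕ → Ω → ℝ) : Prop where
  integrable : ∀ s, Integrable (z s) μ
  condExp_eq_zero : ∀ s, μ[z s | ℱ s] =ᵐ[μ] 0
  lintegral_le : ∀ s, ∀ g : Ω → ENNReal, Measurable[ℱ s] g →
    ∫⁻ ω, g ω * ENNReal.ofReal (z s ω ^ 2) ∂μ ≤ ∫⁻ ω, g ω ∂μ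

/-! ### Tail bounds for the two random quantities. -/

section Tails

variable {p : Params d} {Ω : Type*} {mΩ : MeasurableSpace Ω} {μ : Measure Ω}
  [IsProbabilityMeasure μ] {ℱ : Filtration ℕ mΩ} {D : ℕ → Set (EuclideanSpace ℝ (Fin d))}
  {φ : ℕ → Ω → EuclideanSpace ℝ (Fin d)} {ν y ε : ℕ → Ω → ℝ} {θstar : EuclideanSpace ℝ (Fin d)}

theorem IsHeavyTailedBandit.isUnitNoise (hσmin : 0 < p.σmin)
    (h : IsHeavyTailedBandit μ ℱ D φ ν y ε θstar p.L p.B) :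
    IsUnitNoise μ ℱ fun s ω => p.scaledNoise (φ · ω) (ν · ω) (ε · ω) s := by
  have hσ : ∀ s, StronglyMeasurable[ℱ s] fun ω => p.σ (φ · ω) (ν · ω) (s + 1) :=
    Params.stronglyMeasurable_σ (fun s => h.arm_predictable (s + 1) (by omega))
      (fun s => h.std_predictable (s + 1) (by omega))
  have hdiv := fun s => condExp_div_eq_zero (ℱ.le s) (h.noise_integrable (s + 1) (by omega))
    (hσ s) hσmin (fun ω => p.σmin_le_surrogate _ _ _) (h.noise_mean (s + 1) (by omega))
  exact
    { integrable := fun s => (hdiv s).1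
      condExp_eq_zero := fun s => (hdiv s).2
      lintegral_le := fun s g hg => lintegral_mul_scaled_sq_le (ℱ.le s)
        ((h.noise_adapted (s + 1) (by omega)).measurable.mono (ℱ.le _) le_rfl) (hσ s).measurable
        (fun ω => hσmin.trans_le (p.σmin_le_surrogate _ _ _))
        (fun ω => h.std_nonneg (s + 1) (by omega) ω) (fun ω => p.le_surrogate _ _ _)
        (h.noise_sq (s + 1) (by omega)) hg }

theorem leverage_le_one (φ : ℕ → EuclideanSpace ℝ (Fin d)) (ν : ℕ → ℝ) (s : ℕ) :
    p.leverage φ ν s ≤ 1 :=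
  div_le_one_of_le₀ (by linarith) (by positivity)

/-- Tail bound for the truncated majorant of the self-normalized process. -/
theorem measure_sum_increment_ge_le (hlam : 0 < p.lam) (hσmin : 0 < p.σmin) (hτ₀ : 0 < p.τ₀)
    (h : IsHeavyTailedBandit μ ℱ D φ ν y ε θstar p.L p.B) {η b : ℝ} (hb : p.τ₀ ≤ b) (hη : 0 ≤ η)
    (hη1 : η * (3 * p.τ₀ * b) ≤ 1) (t : ℕ) (ℓ : ℝ) :
    μ {ω | ℓ ≤ ∑ s ∈ Finset.range t, (p.increment (φ · ω) (ν · ω) (ε · ω) η b s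
        - p.leverage (φ · ω) (ν · ω) s * (η * (2 * b / p.τ₀ + 1) + 9 * η ^ 2 * b ^ 2))}
      ≤ ENNReal.ofReal (Real.exp (-ℓ)) := by
  have hφ : ∀ s, StronglyMeasurable[ℱ s] (φ (s + 1)) := fun s => h.arm_predictable _ s.succ_pos
  have hν : ∀ s, StronglyMeasurable[ℱ s] (ν (s + 1)) := fun s => h.std_predictable _ s.succ_pos
  have hε : ∀ s, StronglyMeasurable[ℱ (s + 1)] (ε (s + 1)) := fun s =>
    h.noise_adapted _ s.succ_pos
  have hz := h.isUnitNoise hσmin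
  have hb0 : 0 < b := hτ₀.trans_le hb
  set C := η * (2 * b / p.τ₀ + 1) + 9 * η ^ 2 * b ^ 2
  have hC : 0 ≤ C := by positivity
  have hw0 : ∀ s ω, 0 ≤ p.w (φ · ω) (ν · ω) (s + 1) := fun s ω => wnorm_nonneg _ _
  have ha : ∀ s ω, _ ≤ _ := fun s ω =>
    Params.abs_truncCross_le (φ · ω) (ν · ω) (ε · ω) hlam hb0.le s
  have hinc := fun s ω => exp_increment_le (z := p.scaledNoise (φ · ω) (ν · ω) (ε · ω) s)
    hτ₀ hb hη hη1 (hw0 s ω) (ha s ω) (τ := p.τ (φ · ω) (ν · ω) (s + 1)) rfl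
    (U := p.increment (φ · ω) (ν · ω) (ε · ω) η b s) rfl
  refine measure_sum_ge_le (ℱ := ℱ) (Cb := fun _ => η * (2 * b)) (Cq := fun _ => C)
    (b := fun s ω => η * (2 * p.truncCross (φ · ω) (ν · ω) (ε · ω) b s
      / (1 + p.w (φ · ω) (ν · ω) (s + 1) ^ 2)))
    (q := fun s ω => p.leverage (φ · ω) (ν · ω) s * C)
    (U := fun s ω => p.increment (φ · ω) (ν · ω) (ε · ω) η b s)
    hz.integrable hz.condExp_eq_zero hz.lintegral_le ?_ ?_ ?_ ?_ ?_ ?_ (fun s ω => (hinc s ω).1)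
    (fun s ω => (hinc s ω).2) t ℓ
  · intro s
    exact ((((Params.measurable_truncCross hφ hν hε b s).const_mul 2).div
      (((Params.measurable_w hφ hν s).pow_const 2).const_add 1)).const_mul η).stronglyMeasurable
  · intro s ω
    have hw := hw0 s ω
    have := ha s ω
    rw [abs_mul, abs_of_nonneg hη, abs_div, abs_mul, abs_of_pos (two_pos : (0:ℝ) < 2),
      abs_of_pos (show 0 < 1 + p.w (φ · ω) (ν · ω) (s + 1) ^ 2 by positivity)]
    refine mul_le_mul_of_nonneg_left ?_ hη
    rw [div_le_iff₀ (by positivity)]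
    have h1 : p.w (φ · ω) (ν · ω) (s + 1) ≤ 1 + p.w (φ · ω) (ν · ω) (s + 1) ^ 2 := by
      nlinarith [sq_nonneg (p.w (φ · ω) (ν · ω) (s + 1) - 1)]
    have h2 := mul_le_mul_of_nonneg_right h1 hb0.le
    linarith
  · exact fun s => ((Params.measurable_leverage hφ hν s).mul_const C).stronglyMeasurable
  · exact fun s ω => mul_nonneg (Params.leverage_nonneg _ _ _) hC
  · exact fun s ω => mul_le_of_le_one_left hC (leverage_le_one _ _ _)
  · exact fun s => (Params.measurable_increment hφ hν hε η b s).stronglyMeasurable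

/-- Tail bound for the total leverage of the outliers. -/
theorem measure_sum_outlier_ge_le (hσmin : 0 < p.σmin) (hτ₀ : 0 < p.τ₀)
    (h : IsHeavyTailedBandit μ ℱ D φ ν y ε θstar p.L p.B) {η : ℝ} (hη : 0 ≤ η)
    (hηr : ∀ s ω, η * p.leverage (φ · ω) (ν · ω) s ≤ 1) (t : ℕ) (ℓ : ℝ) :
    μ {ω | ℓ ≤ ∑ s ∈ Finset.range t,
        ((if p.IsOutlier (φ · ω) (ν · ω) (ε · ω) s then η * p.leverage (φ · ω) (ν · ω) s else 0)
        - 8 * η / p.τ₀ ^ 2 * p.leverage (φ · ω) (ν · ω) s ^ 2)}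
      ≤ ENNReal.ofReal (Real.exp (-ℓ)) := by
  have hφ : ∀ s, StronglyMeasurable[ℱ s] (φ (s + 1)) := fun s => h.arm_predictable _ s.succ_pos
  have hν : ∀ s, StronglyMeasurable[ℱ s] (ν (s + 1)) := fun s => h.std_predictable _ s.succ_pos
  have hε : ∀ s, StronglyMeasurable[ℱ (s + 1)] (ε (s + 1)) := fun s =>
    h.noise_adapted _ s.succ_pos
  have hz := h.isUnitNoise hσmin
  have hC : 0 ≤ 8 * η / p.τ₀ ^ 2 := by positivity
  have hw0 : ∀ s ω, 0 ≤ p.w (φ · ω) (ν · ω) (s + 1) := fun s ω => wnorm_nonneg _ _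
  have hinc : ∀ s ω,
      (if p.IsOutlier (φ · ω) (ν · ω) (ε · ω) s then η * p.leverage (φ · ω) (ν · ω) s else 0) ≤ 1 ∧
      Real.exp (if p.IsOutlier (φ · ω) (ν · ω) (ε · ω) s then
        η * p.leverage (φ · ω) (ν · ω) s else 0)
      ≤ 1 + 8 * η / p.τ₀ ^ 2 * p.leverage (φ · ω) (ν · ω) s ^ 2
        * p.scaledNoise (φ · ω) (ν · ω) (ε · ω) s ^ 2 := by
    intro s ω
    convert exp_indicator_le (z := p.scaledNoise (φ · ω) (ν · ω) (ε · ω) s) hτ₀ (hw0 s ω)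
      (τ := p.τ (φ · ω) (ν · ω) (s + 1)) rfl hη (hηr s ω) using 2 <;> rfl
  refine measure_sum_ge_le (ℱ := ℱ) (Cb := fun _ => 0) (Cq := fun _ => 8 * η / p.τ₀ ^ 2)
    (b := fun s ω => 0)
    (q := fun s ω => 8 * η / p.τ₀ ^ 2 * p.leverage (φ · ω) (ν · ω) s ^ 2)
    (U := fun s ω => if p.IsOutlier (φ · ω) (ν · ω) (ε · ω) s then
      η * p.leverage (φ · ω) (ν · ω) s else 0)
    hz.integrable hz.condExp_eq_zero hz.lintegral_le (fun s => stronglyMeasurable_const) (by simp)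
    ?_ ?_ ?_ ?_ (fun s ω => (hinc s ω).1)
    (fun s ω => by simpa using (hinc s ω).2) t ℓ
  · exact fun s =>
      (((Params.measurable_leverage hφ hν s).pow_const 2).const_mul _).stronglyMeasurable
  · exact fun s ω => mul_nonneg hC (sq_nonneg _)
  · exact fun s ω => mul_le_of_le_one_right hC
      (pow_le_one₀ (Params.leverage_nonneg _ _ _) (leverage_le_one _ _ _))
  · intro s
    exact (Measurable.ite (Params.measurableSet_isOutlier hφ hν hε s)
      (((Params.measurable_leverage hφ hν s).mono (ℱ.mono s.le_succ) le_rfl).const_mul η)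
      measurable_const).stronglyMeasurable

end Tails

end AdaOFUL

/-! ### Choice of the parameters and removal of the truncation. -/

namespace AdaOFUL

open Matrix

variable {d : ℕ}

namespace Params

variable (p : Params d)

/-- The high-probability bound for the square root of the self-normalized process. -/
noncomputable def radius (t : ℕ) : ℝ :=
  7 * (p.κ / p.τ₀ + Real.sqrt (p.κ * p.logTerm t) + p.τ₀ * p.logTerm t)

/-- The exponent of the supermartingale that controls the self-normalized process up to
round `t`. -/
noncomputable def rate (t : ℕ) : ℝ :=
  1 / (3 * p.radius t * (p.τ₀ + Real.sqrt (p.κ / p.logTerm t)))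

/-- The factor of the leverage in the compensator of the supermartingale. -/
noncomputable def driftCoeff (t : ℕ) : ℝ :=
  p.rate t * (2 * p.radius t / p.τ₀ + 1) + 9 * p.rate t ^ 2 * p.radius t ^ 2

variable {p}

theorem κ_nonneg (hlam : 0 < p.lam) : 0 ≤ p.κ :=
  mul_nonneg d.cast_nonneg <| Real.log_nonneg <| le_add_of_nonneg_right <| by positivity

theorem radius_mono (hδ : 0 < p.δ) (hτ₀ : 0 < p.τ₀) (hlam : 0 < p.lam) {s t : ℕ} (hs : 1 ≤ s)
    (hst : s ≤ t) : p.radius s ≤ p.radius t := by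
  have := p.logTerm_mono hδ hs hst
  have := κ_nonneg hlam
  unfold radius
  gcongr

/-- If none of the truncated processes is large, then the self-normalized process stays below its
radius, so that no truncation takes place. -/
theorem selfNorm_le_radius_sq (hd : 1 ≤ d) (hlam : 0 < p.lam) (hδ : 0 < p.δ) (hδ1 : p.δ < 1)
    (hσmin : 0 < p.σmin) (hτ₀ : 0 < p.τ₀) (φ : ℕ → EuclideanSpace ℝ (Fin d)) (ν ε : ℕ → ℝ)
    (hφ : ∀ t, 1 ≤ t → ‖φ t‖ ≤ p.L)
    (h : ∀ t, 1 ≤ t → t ≤ p.T → ∑ s ∈ Finset.range t,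
      (p.increment φ ν ε (p.rate t) (p.radius t) s - p.leverage φ ν s * p.driftCoeff t)
        < p.logTerm t)
    (t : ℕ) (ht : 1 ≤ t) (htT : t ≤ p.T) : p.selfNorm φ ν ε t ≤ p.radius t ^ 2 := by
  induction t using Nat.strong_induction_on with
  | _ t ih =>
    obtain ⟨hG, hτβ, hβ⟩ := radius_bound (κ_nonneg hlam) hτ₀ (p.log_two_le_logTerm hδ hδ1 ht)
      (β := p.radius t) rfl rfl
    have hβ0 : 0 < p.radius t := hτ₀.trans_le hτβ
    set G := p.τ₀ + Real.sqrt (p.κ / p.logTerm t) with hGdef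
    have hrate : p.rate t = 1 / (3 * p.radius t * G) := rfl
    have hη : 0 < p.rate t := by rw [hrate]; positivity
    -- The truncation level for horizon `t` is the radius at `t`; since the radius is monotone, the
    -- bounds for earlier rounds imply that it was never reached.
    have hprev : ∀ s < t, p.selfNorm φ ν ε s ≤ p.radius t ^ 2 := by
      intro s hs
      rcases Nat.eq_zero_or_pos s with rfl | hs0
      · simpa [selfNorm, scoreSum] using sq_nonneg (p.radius t)
      · have h0 : 0 ≤ p.radius s := hτ₀.le.trans (radius_bound (κ_nonneg hlam) hτ₀
          (p.log_two_le_logTerm hδ hδ1 hs0) rfl rfl).2.1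
        exact (ih s hs hs0 (by omega)).trans
          (pow_le_pow_left₀ h0 (radius_mono hδ hτ₀ hlam hs0 hs.le) 2)
    have h1 := selfNorm_le_sum φ ν ε hlam (p.rate t) (p.radius t) hη.le t hprev
    have h2 := h t ht htT
    rw [Finset.sum_sub_distrib, ← Finset.sum_mul] at h2
    have hC : 0 ≤ p.driftCoeff t := by unfold driftCoeff; positivity
    have h3 := mul_le_mul_of_nonneg_right (sum_leverage_le φ ν hlam hd hσmin hφ htT) hC
    -- Deviation plus total drift, divided by the rate, is exactly the left side of `radius_bound`.
    have h4 : p.logTerm t + p.κ * p.driftCoeff t = p.rate t *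
        (2 * p.radius t * p.κ / p.τ₀ + p.κ + 3 * p.radius t * p.κ / G
          + 3 * p.radius t * G * p.logTerm t) := by
      rw [driftCoeff, hrate]
      field_simp
      ring
    have h5 := mul_le_mul_of_nonneg_left hβ hη.le
    exact le_of_mul_le_mul_left (by linarith) hη

/-- One event at the horizon serves all rounds, since the outlier leverage is nondecreasing in `t`.
One factor of `r²` in the compensator is absorbed by `r ≤ 1 / (108 ℓ)`, the other is summed to `κ`,
so the compensator is at most `8 κ / τ₀² ≤ 4 ℓ`. The total is then at most `5 ℓ / (108 ℓ) < 1/6`. -/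
theorem sum_outlier_le (hd : 1 ≤ d) (hlam : 0 < p.lam) (hσmin : 0 < p.σmin) (hτ₀ : 0 < p.τ₀)
    (hℓ : 0 < p.logTerm p.T) (hκ : 2 * p.κ ≤ p.τ₀ ^ 2 * p.logTerm p.T)
    (φ : ℕ → EuclideanSpace ℝ (Fin d)) (ν ε : ℕ → ℝ) (hφ : ∀ t, 1 ≤ t → ‖φ t‖ ≤ p.L)
    (h : ∑ s ∈ Finset.range p.T,
      ((if p.IsOutlier φ ν ε s then (108 * p.logTerm p.T) * p.leverage φ ν s else 0)
        - 8 * (108 * p.logTerm p.T) / p.τ₀ ^ 2 * p.leverage φ ν s ^ 2) < p.logTerm p.T)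
    {t : ℕ} (ht : t ≤ p.T) :
    ∑ s ∈ Finset.range t, (if p.IsOutlier φ ν ε s then p.leverage φ ν s else 0) ≤ 1 / 6 := by
  set ℓ := p.logTerm p.T
  have hr0 := leverage_nonneg (p := p) φ ν
  have h1 : ∑ s ∈ Finset.range p.T, 8 * (108 * ℓ) / p.τ₀ ^ 2 * p.leverage φ ν s ^ 2
      ≤ 4 * ℓ := by
    calc _ ≤ ∑ s ∈ Finset.range p.T, 8 / p.τ₀ ^ 2 * p.leverage φ ν s := by
          refine Finset.sum_le_sum fun s _ => ?_
          have := mul_le_mul_of_nonneg_left (leverage_le φ ν hσmin hℓ s)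
            (show 0 ≤ 8 * (108 * ℓ) / p.τ₀ ^ 2 * p.leverage φ ν s by
              have := hr0 s; positivity)
          change _ ≤ _ * (1 / (108 * ℓ)) at this
          refine le_trans (le_of_eq (by ring)) (this.trans (le_of_eq ?_))
          field_simp
      _ = 8 / p.τ₀ ^ 2 * ∑ s ∈ Finset.range p.T, p.leverage φ ν s := by rw [Finset.mul_sum]
      _ ≤ 8 / p.τ₀ ^ 2 * p.κ := by
          gcongr
          exact sum_leverage_le φ ν hlam hd hσmin hφ le_rfl
      _ ≤ 4 * ℓ := by
          rw [div_mul_eq_mul_div, div_le_iff₀ (by positivity)]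
          linarith
  rw [Finset.sum_sub_distrib] at h
  have h2 : ∑ s ∈ Finset.range p.T,
      (if p.IsOutlier φ ν ε s then (108 * ℓ) * p.leverage φ ν s else 0)
      = (108 * ℓ) * ∑ s ∈ Finset.range p.T,
        (if p.IsOutlier φ ν ε s then p.leverage φ ν s else 0) := by
    rw [Finset.mul_sum]
    exact Finset.sum_congr rfl fun s _ => by split_ifs <;> simp
  have h3 : ∑ s ∈ Finset.range t, (if p.IsOutlier φ ν ε s then p.leverage φ ν s else 0)
      ≤ ∑ s ∈ Finset.range p.T, (if p.IsOutlier φ ν ε s then p.leverage φ ν s else 0) :=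
    Finset.sum_le_sum_of_subset_of_nonneg (Finset.range_mono ht)
      fun s _ _ => by split_ifs <;> simp [hr0]
  refine h3.trans (le_of_mul_le_mul_left ?_ (show 0 < 108 * ℓ by positivity))
  linarith

end Params

theorem wnorm_zero_round_le {p : Params d} (hlam : 0 < p.lam) (φ : ℕ → EuclideanSpace ℝ (Fin d))
    (ν : ℕ → ℝ) {x : EuclideanSpace ℝ (Fin d)} (hx : ‖x‖ ≤ p.B) :
    wnorm (p.shape φ ν 0) x ≤ Real.sqrt p.lam * p.B := by
  rw [wnorm, p.shape_zero, smul_mulVec, one_mulVec, dotProduct_smul, ← norm_sq_eq_dotProduct,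
    smul_eq_mul, Real.sqrt_mul hlam.le, Real.sqrt_sq (norm_nonneg _)]
  gcongr

end AdaOFUL

/-! ### The union bound. -/

theorem theorem1 {d : ℕ} (hd : 1 ≤ d) (p : AdaOFUL.Params d)
    (hT : 1 ≤ p.T) (hlam : 0 < p.lam) (hδ : 0 < p.δ) (hδ1 : p.δ < 1) (hσmin : 0 < p.σmin)
    (hτ₀ : max (Real.sqrt (2 * p.κ)) (2 * Real.sqrt d)
      ≤ p.τ₀ * Real.sqrt (Real.log (2 * (p.T : ℝ) ^ 2 / p.δ)))
    {Ω : Type*} {mΩ : MeasurableSpace Ω} (μ : Measure Ω) [IsProbabilityMeasure μ]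
    (ℱ : Filtration ℕ mΩ) (D : ℕ → Set (EuclideanSpace ℝ (Fin d)))
    (φ : ℕ → Ω → EuclideanSpace ℝ (Fin d)) (ν y ε : ℕ → Ω → ℝ)
    (θstar : EuclideanSpace ℝ (Fin d))
    (hbandit : AdaOFUL.IsHeavyTailedBandit μ ℱ D φ ν y ε θstar p.L p.B)
    (θ : ℕ → Ω → EuclideanSpace ℝ (Fin d))
    (hθ : ∀ ω, p.IsEstimator (fun t => φ t ω) (fun t => ν t ω) (fun t => y t ω)
      (fun t => θ t ω)) :
    ENNReal.ofReal (1 - 3 * p.δ) ≤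
      μ {ω | ∀ t ≤ p.T,
        AdaOFUL.wnorm (p.shape (fun s => φ s ω) (fun s => ν s ω) t) (θ t ω - θstar) ≤ p.β t} := by
  have hd0 : (0 : ℝ) < d := by exact_mod_cast hd
  have hℓ : 0 < p.logTerm p.T :=
    (Real.log_pos one_lt_two).trans_le (p.log_two_le_logTerm hδ hδ1 hT)
  change _ ≤ p.τ₀ * Real.sqrt (p.logTerm p.T) at hτ₀
  have hτd := (le_max_right _ _).trans hτ₀
  have hτκ := (le_max_left _ _).trans hτ₀
  have hτpos : 0 < p.τ₀ := by
    have h1 : 0 < 2 * Real.sqrt d := by positivity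
    exact pos_of_mul_pos_left (h1.trans_le hτd) (Real.sqrt_nonneg _)
  have hκ0 := AdaOFUL.Params.κ_nonneg hlam
  have hκ : 2 * p.κ ≤ p.τ₀ ^ 2 * p.logTerm p.T := by
    rw [Real.sqrt_le_left (by positivity), mul_pow, Real.sq_sqrt hℓ.le] at hτκ
    exact hτκ
  set bad : ℕ → Set Ω := fun t => {ω | p.logTerm t ≤ ∑ s ∈ Finset.range t,
    (p.increment (φ · ω) (ν · ω) (ε · ω) (p.rate t) (p.radius t) s
      - p.leverage (φ · ω) (ν · ω) s * p.driftCoeff t)} with hbad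
  set badOut : Set Ω := {ω | p.logTerm p.T ≤ ∑ s ∈ Finset.range p.T,
    ((if p.IsOutlier (φ · ω) (ν · ω) (ε · ω) s then
      (108 * p.logTerm p.T) * p.leverage (φ · ω) (ν · ω) s else 0)
      - 8 * (108 * p.logTerm p.T) / p.τ₀ ^ 2 * p.leverage (φ · ω) (ν · ω) s ^ 2)} with hbadOut
  set good : Set Ω := {ω | ∀ t ≤ p.T,
    AdaOFUL.wnorm (p.shape (fun s => φ s ω) (fun s => ν s ω) t) (θ t ω - θstar) ≤ p.β t}
    with hgood
  have hbound : ∀ t, 1 ≤ t → μ (bad t) ≤ ENNReal.ofReal (p.δ / 2 * ((t : ℝ) ^ 2)⁻¹) := by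
    intro t ht
    obtain ⟨hG, hτβ, -⟩ := AdaOFUL.radius_bound hκ0 hτpos (p.log_two_le_logTerm hδ hδ1 ht)
      (β := p.radius t) rfl rfl
    have hβ0 : 0 < p.radius t := hτpos.trans_le hτβ
    have hη : 0 ≤ p.rate t := by unfold AdaOFUL.Params.rate; positivity
    -- The left side equals `τ₀ / (τ₀ + √(κ / ℓ))`.
    have hη1 : p.rate t * (3 * p.τ₀ * p.radius t) ≤ 1 := by
      rw [AdaOFUL.Params.rate, one_div, inv_mul_le_iff₀ (by positivity), mul_one]
      have : p.τ₀ ≤ p.τ₀ + Real.sqrt (p.κ / p.logTerm t) :=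
        le_add_of_nonneg_right (Real.sqrt_nonneg _)
      nlinarith
    rw [← p.exp_neg_logTerm hδ ht]
    exact AdaOFUL.measure_sum_increment_ge_le hlam hσmin hτpos hbandit hτβ hη hη1 t _
  have hboundOut : μ badOut ≤ ENNReal.ofReal (p.δ / 2) := by
    refine (AdaOFUL.measure_sum_outlier_ge_le hσmin hτpos hbandit
      (η := 108 * p.logTerm p.T) (by positivity) (fun s ω => ?_) p.T _).trans ?_
    · have := AdaOFUL.Params.leverage_le (φ · ω) (ν · ω) hσmin hℓ s
      rw [le_div_iff₀ (by positivity)] at this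
      linarith
    · rw [p.exp_neg_logTerm hδ hT]
      refine ENNReal.ofReal_le_ofReal (mul_le_of_le_one_right (by positivity) ?_)
      have : (1 : ℝ) ≤ p.T := by exact_mod_cast hT
      exact inv_le_one_of_one_le₀ (one_le_pow₀ this)
  -- The estimators are not assumed measurable, so `good` need not be either. Covering the whole
  -- space and using subadditivity avoids taking its complement.
  have hcover : Set.univ ⊆ good ∪ ((⋃ t ∈ Finset.Ioo 0 (p.T + 1), bad t) ∪ badOut) := by
    intro ω _
    by_contra hω
    simp only [Set.mem_union, Set.mem_iUnion, Finset.mem_Ioo, not_or, not_exists] at hω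
    obtain ⟨hω, hω1, hω2⟩ := hω
    refine hω fun t ht => ?_
    have hφ : ∀ t, 1 ≤ t → ‖φ t ω‖ ≤ p.L := fun t ht => hbandit.arm_norm_le t ht ω
    have hB := (norm_nonneg _).trans hbandit.param_norm_le
    obtain ⟨hθ0, hθt⟩ := hθ ω
    rcases Nat.eq_zero_or_pos t with rfl | ht0
    · have h0 : ‖θ 0 ω - θstar‖ ≤ p.B := by
        dsimp only at hθ0
        rw [hθ0, zero_sub, norm_neg]
        exact hbandit.param_norm_le
      simpa [AdaOFUL.Params.β] using AdaOFUL.wnorm_zero_round_le hlam (φ · ω) (ν · ω) h0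
    obtain ⟨hmem, hmin⟩ := hθt t ht0 ht
    have hself := AdaOFUL.Params.selfNorm_le_radius_sq hd hlam hδ hδ1 hσmin hτpos (φ · ω) (ν · ω)
      (ε · ω) hφ (fun s hs hsT => not_le.1 (hω1 s ⟨hs, by omega⟩)) t ht0 ht
    have hout := AdaOFUL.Params.sum_outlier_le hd hlam hσmin hτpos hℓ hκ (φ · ω) (ν · ω)
      (ε · ω) hφ (not_le.1 hω2) ht
    have hτβ := (AdaOFUL.radius_bound hκ0 hτpos (p.log_two_le_logTerm hδ hδ1 ht0)
      (β := p.radius t) rfl rfl).2.1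
    have hfin := AdaOFUL.Params.wnorm_sub_le (φ · ω) (ν · ω) (ε · ω) hlam hd hσmin hℓ hτpos hτd hφ
      (y := (y · ω)) (fun s hs => hbandit.reward_eq s hs ω) hbandit.param_norm_le
      (by simpa using hmem) (hmin (by simpa using hbandit.param_norm_le))
      (hτpos.le.trans hτβ) hself hout
    refine hfin.trans ?_
    -- The bound obtained is `4 (radius + √λ B)`, and `4 ≤ 32 / 7`, `4 ≤ 5`.
    have hr : p.β t = 32 / 7 * p.radius t + 5 * (Real.sqrt p.lam * p.B) := by
      rw [AdaOFUL.Params.β, if_neg ht0.ne', AdaOFUL.Params.radius]; ring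
    have : 0 ≤ Real.sqrt p.lam * p.B := by positivity
    rw [hr]
    linarith
  have hunion : μ (⋃ t ∈ Finset.Ioo 0 (p.T + 1), bad t) ≤ ENNReal.ofReal p.δ := by
    calc _ ≤ ∑ t ∈ Finset.Ioo 0 (p.T + 1), μ (bad t) := measure_biUnion_finset_le _ _
      _ ≤ ∑ t ∈ Finset.Ioo 0 (p.T + 1), ENNReal.ofReal (p.δ / 2 * ((t : ℝ) ^ 2)⁻¹) :=
          Finset.sum_le_sum fun t ht => hbound t (Finset.mem_Ioo.1 ht).1
      _ = ENNReal.ofReal (p.δ / 2 * ∑ t ∈ Finset.Ioo 0 (p.T + 1), ((t : ℝ) ^ 2)⁻¹) := by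
          rw [Finset.mul_sum, ENNReal.ofReal_sum_of_nonneg fun t _ => by positivity]
      _ ≤ ENNReal.ofReal p.δ := by
          refine ENNReal.ofReal_le_ofReal ?_
          -- The inverse squares sum to at most `2`, which cancels the `1/2` in `δ / 2`. With the
          -- outlier event the total failure probability is at most `3δ/2`.
          have := sum_Ioo_inv_sq_le (α := ℝ) 0 (p.T + 1)
          norm_num at this
          nlinarith
  have htotal : 1 ≤ μ good + ENNReal.ofReal (3 * p.δ) := by
    calc 1 = μ Set.univ := measure_univ.symm
      _ ≤ μ good + (μ (⋃ t ∈ Finset.Ioo 0 (p.T + 1), bad t) + μ badOut) :=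
          (measure_mono hcover).trans ((measure_union_le _ _).trans
            (by gcongr; exact measure_union_le _ _))
      _ ≤ μ good + (ENNReal.ofReal p.δ + ENNReal.ofReal (p.δ / 2)) := by gcongr
      _ ≤ _ := by
          rw [← ENNReal.ofReal_add hδ.le (by positivity)]
          gcongr
          linarith
  rw [ENNReal.ofReal_sub _ (by positivity), ENNReal.ofReal_one]
  exact tsub_le_iff_right.2 htotal
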